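/- **Setting.** Let $K$ be a connected, locally finite simplicial complex of dimension $n\ge 1$, every simplex of which lies in an $n$-simplex. Suppose $K$ is boundaryless (no simplex is a face of exactly one simplex of the next dimension) and admissible (for every connected open $U\subset K$, the complement in $U$ of the $(n-2)$-skeleton is connected), and carries a piecewise smooth Riemannian metric: a smooth Riemannian metric $g_\Delta$ on each closed simplex $\Delta$ (smooth up to the boundary), with $g_\Delta|_{\Delta'}=g_{\Delta'}$ for every face $\Delta'\subset\Delta$. Let $\Sigma K$ be the space of links, that is, the set of pairs $z=(x,v)$ with $x\in K$ and $v$ a unit vector of the tangent cone $T_xK$. Let $\lambda_x$ be the normalized Lebesgue measure on the link $\Sigma_xK$, and let $K_D=K\cup\{D\}$ be the one-point compactification of $K$ (with $D$ isolated if $K$ is compact). Functions on $K$ are extended by $f(D)=0$. **Flow.** A *generalized geodesic* starting at $z=(x,v)$ is a curve in $K$ that leaves $x$ with velocity $v$, entering at once the interior of some $n$-simplex, is a geodesic of $g_\Delta$ in the interior of each $n$-simplex $\Delta$, and otherwise only meets interior points of $(n-1)$-simplices $\Delta'$, transversally. There it passes from an $n$-simplex $\Delta_1\supset\Delta'$ to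 another $n$-simplex $\Delta_2\supset\Delta'$, and its velocity $u-a\,\nu_{\Delta_1}$ becomes $u+a\,\nu_{\Delta_2}$, where $u$ is tangent to $\Delta'$, $a>0$, and $\nu_{\Delta_i}$ is the unit normal of $\Delta'$ pointing into $\Delta_i$. A *generalized geodesic flow* is a Borel map $(z,t)\mapsto X_z(t)\in K_D$ on $\Sigma K\times[0,\infty)$ such that, for each $z=(x,v)$, $X_z(0)=x$ and $X_z$ follows a generalized geodesic starting at $z$ that cannot be continued further, on its interval of existence $[0,\zeta)$, and $X_z(t)=D$ for $t\ge\zeta$, $t>0$ (with $\zeta=0$ if no generalized geodesic starts at $z$). Fix such a flow $X$. **Process.** Put $X_D\equiv D$ and $\lambda_D=\delta_D$. For $x\in K$ let $P^x$ be the law of the Markov chain $(Z_k,\tau_k)_{k\ge0}$ on $(\Sigma K\cup\{D\})\times[0,\infty)$ with initial law $\lambda_x\otimes\delta_0$ and the following transitions: from $(z,t)$ the chain moves to $(z',t+s)$, where $s$ is exponentially distributed with parameter $1$ and, given $s$, $z'$ has law $\lambda_{X_z(s)}$. The *isotropic transport process* is $Y_t=X_{Z_i}(t-\tau_i)$ for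 $\tau_i\le t<\tau_{i+1}$, and $Y_t=D$ for $t\ge\lim_k\tau_k$. **Operators.** For bounded Borel $f:K\to\mathbb R$, $t\ge0$ and $\lambda>0$ put $$T^0_tf(x)=\int_{\Sigma_xK}f(X_{(x,\eta)}(t))\,d\lambda_x(\eta),\qquad T_tf(x)=E^x[f(Y_t)],$$ $$R^0_\lambda f(x)=\int_0^\infty e^{-\lambda t}\,T^0_tf(x)\,dt,\qquad R_\lambda f(x)=\int_0^\infty e^{-\lambda t}\,T_tf(x)\,dt.$$ **Proposition 2.4.** Let $\lambda>0$ and let $f:K\to\mathbb R$ be a bounded Borel function (for instance $f\in C_0(K)$). The integrals defining $T^0_tf$, $T_tf$, $R^0_{\lambda+1}f$ and $R_\lambda f$ converge absolutely. The operator $R^0_{\lambda+1}$ maps bounded Borel functions to bounded Borel functions, with $\|R^0_{\lambda+1}\|\le\frac1{\lambda+1}$ for the sup norm. Moreover $$R_\lambda f=\sum_{n\ge0}(R^0_{\lambda+1})^{n+1}f,$$ where the series converges uniformly on $K$. -/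

import Mathlib

open MeasureTheory ProbabilityTheory Set Filter Topology
open scoped NNReal ENNReal ZeroAtInfty

noncomputable section

namespace TransportProcess

variable {V : Type*}

/-! ### Simplicial complexes in barycentric coordinates -/

/-- The closed simplex spanned by `s`, in barycentric coordinates: the functions on the vertex set
that vanish off `s` and whose restriction to `s` is nonnegative with sum one. -/
def closedSimplex (s : Finset V) : Set (V → ℝ) :=
  {x | (∀ v, v ∉ s → x v = 0) ∧ s.restrict x ∈ stdSimplex ℝ s}

/-- The topological interior of the simplex spanned by `s`. -/
def openSimplex (s : Finset V) : Set (V → ℝ) :=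
  {x | x ∈ closedSimplex s ∧ ∀ v ∈ s, 0 < x v}

/-- The vectors tangent to the simplex spanned by `s`. -/
def IsTangent (s : Finset V) (w : V → ℝ) : Prop :=
  (∀ v, v ∉ s → w v = 0) ∧ ∑ v ∈ s, w v = 0

/-- The tangent cone at `x` of the simplex spanned by `s`: the tangent vectors that do not point
out of the simplex. -/
def tangentCone (s : Finset V) (x : V → ℝ) : Set (V → ℝ) :=
  {w | IsTangent s w ∧ ∀ v ∈ s, x v = 0 → 0 ≤ w v}

/-- The geometric realization of a simplicial complex. For a locally finite complex the subspace
topology coming from the product topology of `V → ℝ` is the usual topology of the realization. -/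
def realization (K : AbstractSimplicialComplex V) : Set (V → ℝ) :=
  {x | ∃ s ∈ K.faces, x ∈ closedSimplex s}

/-- The union of the simplices of dimension less than `n - 1`, that is with fewer than `n`
vertices. -/
def codimTwoSkeleton (K : AbstractSimplicialComplex V) (n : ℕ) : Set (V → ℝ) :=
  {x | ∃ s ∈ K.faces, s.card < n ∧ x ∈ closedSimplex s}

/-- A connected, locally finite, boundaryless, admissible simplicial complex of dimension `n ≥ 1`
with a piecewise smooth Riemannian metric. -/
structure RiemannianComplex (V : Type*) (n : ℕ) extends AbstractSimplicialComplex V where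
  one_le_dim : 1 ≤ n
  /-- The complex has dimension `n`, and it is dimensionally homogeneous. -/
  exists_top : ∀ s ∈ faces, ∃ t ∈ faces, s ⊆ t ∧ t.card = n + 1
  locallyFinite : ∀ v : V, {s | s ∈ faces ∧ v ∈ s}.Finite
  connected : IsConnected (realization toAbstractSimplicialComplex)
  /-- No simplex is adjacent to exactly one simplex of the next dimension. -/
  boundaryless : ∀ s ∈ faces, ¬ ∃! t, t ∈ faces ∧ s ⊆ t ∧ t.card = s.card + 1
  /-- Admissibility: the skeleton of codimension two does not disconnect any connected open
  subset. -/
  admissible : ∀ U : Set (V → ℝ), IsOpen U →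
    IsConnected (realization toAbstractSimplicialComplex ∩ U) →
    IsConnected ((realization toAbstractSimplicialComplex ∩ U) \
      codimTwoSkeleton toAbstractSimplicialComplex n)
  /-- The Riemannian metric of the simplex `s`, as a field of bilinear forms on `ℝ^s`. Only its
  values at the points of the simplex, on vectors tangent to the simplex, are relevant. -/
  metric : ∀ s : Finset V, (s → ℝ) → (s → ℝ) →L[ℝ] (s → ℝ) →L[ℝ] ℝ
  metric_smooth : ∀ s ∈ faces, ∃ U : Set (s → ℝ), IsOpen U ∧ stdSimplex ℝ s ⊆ U ∧
    ContDiffOn ℝ ((⊤ : ℕ∞) : WithTop ℕ∞) (metric s) U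
  metric_symm : ∀ s ∈ faces, ∀ x ∈ stdSimplex ℝ s, ∀ w w' : s → ℝ,
    ∑ i, w i = 0 → ∑ i, w' i = 0 → metric s x w w' = metric s x w' w
  metric_pos : ∀ s ∈ faces, ∀ x ∈ stdSimplex ℝ s, ∀ w : s → ℝ,
    ∑ i, w i = 0 → w ≠ 0 → 0 < metric s x w w
  /-- The metric of a simplex restricts to the metric of each of its faces. -/
  metric_compat : ∀ s ∈ faces, ∀ t ∈ faces, t ⊆ s → ∀ x ∈ closedSimplex t, ∀ w w' : V → ℝ,
    IsTangent t w → IsTangent t w' →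
    metric t (t.restrict x) (t.restrict w) (t.restrict w') =
      metric s (s.restrict x) (s.restrict w) (s.restrict w')

namespace RiemannianComplex

variable {n : ℕ} (K : RiemannianComplex V n)

/-- The underlying space of the complex. -/
abbrev Space : Type _ := ↥(realization K.toAbstractSimplicialComplex)

/-- The scalar product `g_s(x)(w, w')` on the tangent space of the simplex `s` at `x`. -/
def inner (s : Finset V) (x w w' : V → ℝ) : ℝ :=
  K.metric s (s.restrict x) (s.restrict w) (s.restrict w')

/-- The simplices of dimension `n`. -/
abbrev Top : Type _ := {s : Finset V // s ∈ K.faces ∧ s.card = n + 1}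

/-- The space of links: the pairs `(x, w)` with `x` a point of the complex and `w` a unit vector
of the tangent cone at `x`. -/
def sphereBundle : Set ((V → ℝ) × (V → ℝ)) :=
  {p | ∃ s ∈ K.faces, p.1 ∈ closedSimplex s ∧ p.2 ∈ tangentCone s p.1 ∧ K.inner s p.1 p.2 p.2 = 1}

/-- The type of the elements of the space of links. -/
abbrev Sphere : Type _ := ↥K.sphereBundle

/-- The base point of an element of the space of links. -/
def base (z : K.Sphere) : K.Space :=
  ⟨z.1.1, let ⟨s, hs, hx, _⟩ := z.2; ⟨s, hs, hx⟩⟩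

/-! ### The uniform measure on the links -/

/-- Linear coordinates on the tangent space of an `n`-simplex with vertices `v_0, …, v_n`: the
vector with coordinates `u` is the sum of the `u_i (v_{i+1} - v_0)`. -/
def tangentVec (s : K.Top) (u : Fin n → ℝ) : V → ℝ := by
  classical
  exact fun v => if h : v ∈ s.1 then
    (Fin.cons (- ∑ i, u i) u : Fin (n + 1) → ℝ) (s.1.equivFinOfCardEq s.2.2 ⟨v, h⟩) else 0

/-- The squared length at `x` of the tangent vector with coordinates `u`. -/
def lengthSq (s : K.Top) (x : V → ℝ) (u : Fin n → ℝ) : ℝ :=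
  K.inner s.1 x (K.tangentVec s u) (K.tangentVec s u)

/-- The Gram matrix of the metric at `x`, in the coordinates `tangentVec`. -/
def gram (s : K.Top) (x : V → ℝ) : Matrix (Fin n) (Fin n) ℝ :=
  Matrix.of fun i j =>
    K.inner s.1 x (K.tangentVec s (Pi.single i 1)) (K.tangentVec s (Pi.single j 1))

/-- The coordinates of the nonzero vectors of length at most one in the tangent cone at `x`. -/
def coneBall (s : K.Top) (x : V → ℝ) : Set (Fin n → ℝ) :=
  {u | K.tangentVec s u ∈ tangentCone s.1 x ∧ 0 < K.lengthSq s x u ∧ K.lengthSq s x u ≤ 1}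

/-- Radial projection of the tangent vector with coordinates `u` to the unit sphere. -/
def direction (s : K.Top) (x : V → ℝ) (u : Fin n → ℝ) : (V → ℝ) × (V → ℝ) :=
  (x, (√(K.lengthSq s x u))⁻¹ • K.tangentVec s u)

/-- The (unnormalized) Lebesgue measure on the link of `x`: on the part of the link in an
`n`-simplex `s`, the measure of a set of directions is the Riemannian volume, for the Euclidean
structure `g_s(x)` of the tangent space, of the part of the unit ball lying in these directions
(this is `1 / n` times the spherical Lebesgue measure). -/
def linkMeasure (x : V → ℝ) : Measure ((V → ℝ) × (V → ℝ)) := by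
  classical
  exact Measure.sum fun s : K.Top =>
    if x ∈ closedSimplex s.1 then
      ENNReal.ofReal (√(K.gram s x).det) •
        (volume.restrict (K.coneBall s x)).map (K.direction s x)
    else 0

/-- The uniform measure on the link of `x`: the normalized Lebesgue measure, as a measure on the
space of links. -/
def uniformMeasure (x : K.Space) : Measure K.Sphere :=
  ((K.linkMeasure x.1 univ)⁻¹ • K.linkMeasure x.1).comap Subtype.val

/-! ### Measurability and total mass of the uniform measure -/

section Aux

lemma exists_pos {s : Finset V} {x : V → ℝ} (hx : x ∈ closedSimplex s) : ∃ v ∈ s, 0 < x v := by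
  by_contra! h
  have h1 : ∑ i, s.restrict x i ≤ 0 := Finset.sum_nonpos fun i _ => h i i.2
  rw [hx.2.2] at h1
  linarith

lemma tangentVec_eq (s : K.Top) (u : Fin n → ℝ) (v : V) (h : v ∈ s.1) :
    K.tangentVec s u v =
      (Fin.cons (- ∑ i, u i) u : Fin (n + 1) → ℝ) (s.1.equivFinOfCardEq s.2.2 ⟨v, h⟩) := by
  simp [tangentVec, h]

lemma tangentVec_zero (s : K.Top) (u : Fin n → ℝ) (v : V) (h : v ∉ s.1) :
    K.tangentVec s u v = 0 := by
  simp [tangentVec, h]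

lemma continuous_tangentVec (s : K.Top) : Continuous (K.tangentVec s) := by
  refine continuous_pi fun v => ?_
  by_cases h : v ∈ s.1
  · simp only [tangentVec_eq K s _ v h]
    generalize (s.1.equivFinOfCardEq s.2.2 ⟨v, h⟩) = j
    refine Fin.cases ?_ (fun i => ?_) j
    · simp only [Fin.cons_zero]; fun_prop
    · simp only [Fin.cons_succ]; fun_prop
  · simp only [tangentVec_zero K s _ v h]; fun_prop

lemma sum_tangentVec (s : K.Top) (u : Fin n → ℝ) :
    ∑ i, s.1.restrict (K.tangentVec s u) i = 0 := by
  have : ∀ i : s.1, s.1.restrict (K.tangentVec s u) i =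
      (Fin.cons (- ∑ i, u i) u : Fin (n + 1) → ℝ) (s.1.equivFinOfCardEq s.2.2 i) := fun i => by
    rw [Finset.restrict_def]; exact tangentVec_eq K s u i.1 i.2
  simp only [this]
  rw [Equiv.sum_comp (s.1.equivFinOfCardEq s.2.2)
    (fun j => (Fin.cons (- ∑ i, u i) u : Fin (n + 1) → ℝ) j), Fin.sum_univ_succ]
  simp

lemma isTangent_tangentVec (s : K.Top) (u : Fin n → ℝ) : IsTangent s.1 (K.tangentVec s u) := by
  refine ⟨fun v hv => tangentVec_zero K s u v hv, ?_⟩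
  rw [← sum_tangentVec K s u, ← Finset.sum_coe_sort]
  rfl

/-- The coordinates `tangentVec`, with values in `ℝ^s`, as a linear map. -/
def tangentLin (s : K.Top) : (Fin n → ℝ) →ₗ[ℝ] (s.1 → ℝ) where
  toFun u := s.1.restrict (K.tangentVec s u)
  map_add' u w := by
    ext i
    simp only [Finset.restrict_def, Pi.add_apply, tangentVec_eq K s _ i.1 i.2]
    generalize (s.1.equivFinOfCardEq s.2.2 ⟨i.1, i.2⟩) = j
    refine Fin.cases ?_ (fun i => ?_) j
    · simp [Finset.sum_add_distrib]; ring
    · simp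
  map_smul' c u := by
    ext i
    simp only [Finset.restrict_def, Pi.smul_apply, tangentVec_eq K s _ i.1 i.2]
    generalize (s.1.equivFinOfCardEq s.2.2 ⟨i.1, i.2⟩) = j
    refine Fin.cases ?_ (fun i => ?_) j
    · simp [Finset.mul_sum]
    · simp

lemma tangentLin_injective (s : K.Top) : Function.Injective (K.tangentLin s) := by
  rw [← LinearMap.ker_eq_bot, LinearMap.ker_eq_bot']
  intro u hu
  ext i
  have h := congrFun hu ((s.1.equivFinOfCardEq s.2.2).symm i.succ)
  change K.tangentVec s u _ = 0 at h
  rw [tangentVec_eq K s u _ ((s.1.equivFinOfCardEq s.2.2).symm i.succ).2] at h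
  simpa using h


lemma continuousOn_metric {s : Finset V} (hs : s ∈ K.faces) :
    ContinuousOn (K.metric s) (stdSimplex ℝ s) := by
  obtain ⟨U, -, hU, h⟩ := K.metric_smooth s hs
  exact h.continuousOn.mono hU

lemma isClosed_closedSimplex (s : Finset V) : IsClosed (closedSimplex s : Set (V → ℝ)) := by
  have h1 : IsClosed {x : V → ℝ | ∀ v, v ∉ s → x v = 0} := by
    simp only [Set.ofPred_forall]
    exact isClosed_iInter fun v => isClosed_iInter fun _ =>
      isClosed_eq (continuous_apply v) continuous_const
  have h2 : Continuous (fun x : V → ℝ => s.restrict x) :=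
    continuous_pi fun i => continuous_apply i.1
  exact h1.inter ((isClosed_stdSimplex (𝕜 := ℝ) (ι := s)).preimage h2)

lemma continuous_inner {s : Finset V} (hs : s ∈ K.faces) :
    Continuous fun p : ↥(closedSimplex s) × (V → ℝ) × (V → ℝ) =>
      K.inner s p.1 p.2.1 p.2.2 := by
  have h2 : Continuous (fun x : V → ℝ => s.restrict x) :=
    continuous_pi fun i => continuous_apply i.1
  have h3 : Continuous fun p : ↥(closedSimplex s) => K.metric s (s.restrict p.1) := by
    have := (K.continuousOn_metric hs).comp_continuous
      (f := fun p : ↥(closedSimplex s) => s.restrict p.1)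
      (h2.comp continuous_subtype_val) (fun p => p.2.2)
    exact this
  unfold inner
  exact ((h3.comp continuous_fst).clm_apply (h2.comp (continuous_fst.comp continuous_snd))).clm_apply
    (h2.comp (continuous_snd.comp continuous_snd))

lemma continuous_lengthSq (s : K.Top) :
    Continuous fun p : ↥(closedSimplex s.1) × (Fin n → ℝ) =>
      K.lengthSq s p.1 p.2 :=
  (K.continuous_inner s.2.1).comp
    (f := fun p : ↥(closedSimplex s.1) × (Fin n → ℝ) =>
      (p.1, K.tangentVec s p.2, K.tangentVec s p.2))
    (continuous_fst.prodMk (((K.continuous_tangentVec s).comp continuous_snd).prodMk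
      ((K.continuous_tangentVec s).comp continuous_snd)))

lemma lengthSq_eq (s : K.Top) (x : V → ℝ) (u : Fin n → ℝ) :
    K.lengthSq s x u = K.metric s.1 (s.1.restrict x) (K.tangentLin s u) (K.tangentLin s u) := rfl

lemma lengthSq_smul (s : K.Top) (x : V → ℝ) (c : ℝ) (u : Fin n → ℝ) :
    K.lengthSq s x (c • u) = c ^ 2 * K.lengthSq s x u := by
  simp only [lengthSq_eq, map_smul, smul_apply, smul_eq_mul]
  ring

lemma lengthSq_pos (s : K.Top) {x : V → ℝ} (hx : x ∈ closedSimplex s.1) {u : Fin n → ℝ}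
    (hu : u ≠ 0) : 0 < K.lengthSq s x u := by
  refine K.metric_pos s.1 s.2.1 _ hx.2 _ (K.sum_tangentVec s u) fun h => hu ?_
  exact K.tangentLin_injective s (h.trans (map_zero _).symm)

lemma det_gram_pos (s : K.Top) {x : V → ℝ} (hx : x ∈ closedSimplex s.1) :
    0 < (K.gram s x).det := by
  refine Matrix.PosDef.det_pos (Matrix.PosDef.of_dotProduct_mulVec_pos ?_ fun u hu => ?_)
  · ext i j
    exact K.metric_symm s.1 s.2.1 _ hx.2 _ _ (K.sum_tangentVec s _) (K.sum_tangentVec s _)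
  · have h := K.lengthSq_pos s hx hu
    suffices h' : star u ⬝ᵥ (K.gram s x).mulVec u = K.lengthSq s x u by rw [h']; exact h
    have e : K.tangentLin s u = ∑ i, u i • K.tangentLin s (Pi.single i 1) := by
      conv_lhs => rw [pi_eq_sum_univ' u]
      simp only [map_sum, map_smul]
    rw [lengthSq_eq, e]
    simp only [dotProduct, Matrix.mulVec, gram, map_sum, map_smul, Finset.mul_sum,
      sum_apply, smul_apply, smul_eq_mul, Matrix.of_apply,
      star_trivial]
    rw [Finset.sum_comm]
    refine Finset.sum_congr rfl fun i _ => Finset.sum_congr rfl fun j _ => ?_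
    change _ * (K.metric s.1 _ (K.tangentLin s _) (K.tangentLin s _) * _) = _
    ring

lemma volume_coneBall_lt_top (s : K.Top) {x : V → ℝ} (hx : x ∈ closedSimplex s.1) :
    volume (K.coneBall s x) < ∞ := by
  have : Nonempty (Fin n) := ⟨⟨0, K.one_le_dim⟩⟩
  have hcont : Continuous (K.lengthSq s x) :=
    (K.continuous_lengthSq s).comp (f := fun u => ((⟨x, hx⟩ : ↥(closedSimplex s.1)), u))
      (by fun_prop)
  obtain ⟨u₀, h₀, hmin⟩ := (isCompact_sphere (0 : Fin n → ℝ) 1).exists_isMinOn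
    (NormedSpace.sphere_nonempty.2 zero_le_one) hcont.continuousOn
  have hu₀ : u₀ ≠ 0 := by rintro rfl; simp at h₀
  have hm := K.lengthSq_pos s hx hu₀
  refine lt_of_le_of_lt (measure_mono (t := Metric.closedBall 0 (√(K.lengthSq s x u₀))⁻¹) ?_)
    measure_closedBall_lt_top
  rintro u ⟨-, h1, h2⟩
  have hu : u ≠ 0 := by rintro rfl; simp [lengthSq_eq] at h1
  have hn : 0 < ‖u‖ := norm_pos_iff.2 hu
  have h3 : K.lengthSq s x u₀ ≤ K.lengthSq s x (‖u‖⁻¹ • u) :=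
    hmin (by simp [norm_smul, hn.ne'])
  rw [lengthSq_smul] at h3
  have h4 : K.lengthSq s x u₀ * ‖u‖ ^ 2 ≤ 1 := by
    calc _ ≤ (‖u‖⁻¹ ^ 2 * K.lengthSq s x u) * ‖u‖ ^ 2 := by gcongr
      _ = K.lengthSq s x u := by field_simp
      _ ≤ 1 := h2
  have h5 : √(K.lengthSq s x u₀) * ‖u‖ ≤ 1 := by
    rw [← Real.sqrt_sq hn.le, ← Real.sqrt_mul hm.le]
    exact Real.sqrt_le_one.2 h4
  rw [mem_closedBall_zero_iff, ← one_div, le_div_iff₀ (Real.sqrt_pos.2 hm), mul_comm]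
  exact h5

lemma volume_coneBall_pos (s : K.Top) {x : V → ℝ} (hx : x ∈ closedSimplex s.1) :
    0 < volume (K.coneBall s x) := by
  classical
  have hcont : Continuous (K.lengthSq s x) :=
    (K.continuous_lengthSq s).comp (f := fun u => ((⟨x, hx⟩ : ↥(closedSimplex s.1)), u))
      (by fun_prop)
  obtain ⟨j, hj⟩ : ∃ j : s.1, 0 < x j :=
    let ⟨v, hv, h⟩ := exists_pos hx; ⟨⟨v, hv⟩, h⟩
  let O : Set (Fin n → ℝ) := {u | (∀ v ∈ s.1, v ≠ j.1 → 0 < K.tangentVec s u v) ∧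
    0 < K.lengthSq s x u ∧ K.lengthSq s x u < 1}
  have hO : IsOpen O := by
    have e : O = (⋂ v ∈ s.1.erase j.1, {u | 0 < K.tangentVec s u v}) ∩
        ({u | 0 < K.lengthSq s x u} ∩ {u | K.lengthSq s x u < 1}) := by
      ext u
      simp only [O, mem_inter_iff, mem_iInter, Finset.mem_erase, mem_ofPred_eq]
      tauto
    rw [e]
    refine IsOpen.inter (isOpen_biInter_finset fun v _ => isOpen_lt continuous_const
      ((continuous_apply v).comp (K.continuous_tangentVec s))) ((isOpen_lt continuous_const
      hcont).inter (isOpen_lt hcont continuous_const))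
  have hsub : O ⊆ K.coneBall s x := by
    rintro u ⟨h1, h2, h3⟩
    refine ⟨⟨K.isTangent_tangentVec s u, fun v hv hxv => ?_⟩, h2, h3.le⟩
    by_cases hvj : v = j.1
    · rw [hvj] at hxv; exact absurd hxv hj.ne'
    · exact (h1 v hv hvj).le
  have hne : O.Nonempty := by
    let w : s.1 → ℝ := fun i => if i = j then - (n : ℝ) else 1
    have hw : ∑ i, w i = 0 := by
      have : ∑ i, w i = w j + ∑ i ∈ Finset.univ.erase j, w i :=
        (Finset.add_sum_erase _ _ (Finset.mem_univ j)).symm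
      rw [this, Finset.sum_congr rfl (g := fun _ => (1 : ℝ))
        (fun i hi => by simp [w, (Finset.mem_erase.1 hi).1])]
      simp [w, s.2.2]
    let e := s.1.equivFinOfCardEq s.2.2
    let u : Fin n → ℝ := fun i => w (e.symm i.succ)
    have hu : ∀ v (h : v ∈ s.1), K.tangentVec s u v = w ⟨v, h⟩ := fun v h => by
      rw [tangentVec_eq K s u v h]
      have h2 : (Fin.cons (- ∑ i, u i) u : Fin (n + 1) → ℝ) = fun k => w (e.symm k) := by
        have h3 : ∑ k, w (e.symm k) = 0 := by rw [Equiv.sum_comp e.symm w, hw]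
        rw [Fin.sum_univ_succ] at h3
        ext k
        refine Fin.cases ?_ (fun i => ?_) k
        · simp only [Fin.cons_zero, u]; linarith
        · simp [u]
      rw [h2]
      simp [e]
    have hu0 : u ≠ 0 := by
      intro h0
      have h1 := hu j.1 j.2
      have h2 : K.tangentVec s u j.1 = 0 := by
        have := congrFun (map_zero (K.tangentLin s)) j
        rw [h0]; exact this
      have : (n : ℝ) ≠ 0 := by have := K.one_le_dim; positivity
      rw [h2] at h1
      simp only [w, if_true] at h1
      exact this (neg_eq_zero.1 h1.symm)
    have hN := K.lengthSq_pos s hx hu0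
    set N := K.lengthSq s x u with hNdef
    refine ⟨(1 + N)⁻¹ • u, fun v hv hvj => ?_, ?_, ?_⟩
    · have h1 : K.tangentVec s ((1 + N)⁻¹ • u) v = (1 + N)⁻¹ * K.tangentVec s u v :=
        congrFun (map_smul (K.tangentLin s) (1 + N)⁻¹ u) ⟨v, hv⟩
      have h2 : w ⟨v, hv⟩ = 1 := if_neg fun h => hvj (congrArg Subtype.val h)
      rw [h1, hu v hv, h2]
      positivity
    · rw [lengthSq_smul]; positivity
    · rw [lengthSq_smul, inv_pow, inv_mul_lt_iff₀ (by positivity)]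
      nlinarith
  exact lt_of_lt_of_le (hO.measure_pos volume hne) (measure_mono hsub)

lemma direction_mem (s : K.Top) {x : V → ℝ} (hx : x ∈ closedSimplex s.1) {u : Fin n → ℝ}
    (hu : u ∈ K.coneBall s x) : K.direction s x u ∈ K.sphereBundle := by
  obtain ⟨⟨⟨h1, h2⟩, h3⟩, h4, -⟩ := hu
  refine ⟨s.1, s.2.1, hx, ⟨⟨fun v hv => ?_, ?_⟩, fun v hv h0 => ?_⟩, ?_⟩
  · simp [direction, h1 v hv]
  · simp [direction, ← Finset.mul_sum, h2]
  · exact mul_nonneg (by positivity) (h3 v hv h0)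
  · have h5 : K.inner s.1 x ((√(K.lengthSq s x u))⁻¹ • K.tangentVec s u)
        ((√(K.lengthSq s x u))⁻¹ • K.tangentVec s u) =
        K.lengthSq s x ((√(K.lengthSq s x u))⁻¹ • u) := by
      rw [lengthSq_eq K s x ((√(K.lengthSq s x u))⁻¹ • u), map_smul]; rfl
    change K.inner s.1 x ((√(K.lengthSq s x u))⁻¹ • K.tangentVec s u)
        ((√(K.lengthSq s x u))⁻¹ • K.tangentVec s u) = 1
    rw [h5, lengthSq_smul, inv_pow, Real.sq_sqrt h4.le, inv_mul_cancel₀ h4.ne']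

lemma exists_mem_top (x : K.Space) : ∃ s : K.Top, x.1 ∈ closedSimplex s.1 := by
  classical
  obtain ⟨x, t, ht, hx⟩ := x
  obtain ⟨s, hs, hts, hc⟩ := K.exists_top t ht
  refine ⟨⟨s, hs, hc⟩, fun v hv => hx.1 v fun h => hv (hts h), fun i => ?_, ?_⟩
  · by_cases h : i.1 ∈ t
    · exact hx.2.1 ⟨i.1, h⟩
    · exact (hx.1 i.1 h).ge
  · have h1 : ∑ i ∈ t, x i = 1 := by rw [← hx.2.2, ← Finset.sum_coe_sort]; rfl
    have h2 : ∑ i ∈ s, x i = 1 := by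
      rw [← h1]; exact (Finset.sum_subset hts fun v _ hv => hx.1 v hv).symm
    rw [← Finset.sum_coe_sort] at h2
    exact h2

lemma finite_top (x : K.Space) : {s : K.Top | x.1 ∈ closedSimplex s.1}.Finite := by
  obtain ⟨s₀, hx⟩ := K.exists_mem_top x
  obtain ⟨j, hj⟩ : ∃ j : s₀.1, 0 < x.1 j :=
    let ⟨v, hv, h⟩ := exists_pos hx; ⟨⟨v, hv⟩, h⟩
  refine Finite.of_finite_image (f := Subtype.val) ((K.locallyFinite j.1).subset ?_)
    Subtype.val_injective.injOn
  rintro _ ⟨s, hs, rfl⟩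
  refine ⟨s.2.1, ?_⟩
  by_contra h
  exact hj.ne' (hs.1 j.1 h)

/-- A connected locally finite complex has countably many vertices. -/
lemma countable_vertices (K : RiemannianComplex V n) : Countable V := by
  classical
  rcases isEmpty_or_nonempty V with hV | ⟨⟨v₀⟩⟩
  · infer_instance
  let C : ℕ → Set V := fun k =>
    Nat.rec {v₀} (fun _ D => ⋃ v ∈ D, ⋃ s ∈ {s | s ∈ K.faces ∧ v ∈ s}, (s : Set V)) k
  have hC : ∀ k, (C k).Countable := fun k => by
    induction k with
    | zero => exact countable_singleton v₀
    | succ k ih =>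
      exact ih.biUnion fun v _ => (K.locallyFinite v).countable.biUnion fun s _ =>
        s.finite_toSet.countable
  have hstep : ∀ k, ∀ v ∈ C k, ∀ s ∈ K.faces, v ∈ s → ∀ w ∈ s, w ∈ C (k + 1) := by
    intro k v hv s hs hvs w hw
    exact mem_biUnion hv (mem_biUnion (show s ∈ {s | s ∈ K.faces ∧ v ∈ s} from ⟨hs, hvs⟩) hw)
  let D : Set V := ⋃ k, C k
  have hD : D.Countable := countable_iUnion hC
  have hclosed : ∀ v ∈ D, ∀ s ∈ K.faces, v ∈ s → ∀ w ∈ s, w ∈ D := by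
    intro v hv s hs hvs w hw
    obtain ⟨k, hk⟩ := mem_iUnion.1 hv
    exact mem_iUnion.2 ⟨k + 1, hstep k v hk s hs hvs w hw⟩
  have hv₀ : v₀ ∈ D := mem_iUnion.2 ⟨0, rfl⟩
  have hdelta : ∀ v : V, (Pi.single v 1 : V → ℝ) ∈ realization K.toAbstractSimplicialComplex := by
    intro v
    refine ⟨{v}, K.singleton_mem v, fun w hw => ?_, fun i => ?_, ?_⟩
    · exact Pi.single_eq_of_ne (by simpa using hw) _
    · simp only [Finset.restrict_def, Pi.single_apply]; split_ifs <;> norm_num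
    · simp
  have hopen : ∀ E : Set V, IsOpen {x : V → ℝ | ∃ v ∈ E, 0 < x v} := by
    intro E
    have e : {x : V → ℝ | ∃ v ∈ E, 0 < x v} = ⋃ v ∈ E, {x | 0 < x v} := by ext x; simp
    rw [e]
    exact isOpen_biUnion fun v _ => isOpen_lt continuous_const (continuous_apply v)
  have hall : ∀ v, v ∈ D := by
    by_contra! ⟨v, hv⟩
    obtain ⟨x, ⟨s, hs, hx⟩, ⟨a, ha, hxa⟩, ⟨b, hb, hxb⟩⟩ :=
      K.connected.isPreconnected _ _ (hopen D) (hopen Dᶜ) (by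
        rintro x ⟨s, hs, hx⟩
        obtain ⟨w, -, hw⟩ := exists_pos hx
        by_cases h : w ∈ D
        · exact Or.inl ⟨w, h, hw⟩
        · exact Or.inr ⟨w, h, hw⟩)
        ⟨_, hdelta v₀, v₀, hv₀, by simp⟩ ⟨_, hdelta v, v, hv, by simp⟩
    have has : a ∈ s := by by_contra h; exact hxa.ne' (hx.1 a h)
    have hbs : b ∈ s := by by_contra h; exact hxb.ne' (hx.1 b h)
    exact hb (hclosed a ha s hs has b hbs)
  exact countable_univ_iff.1 (hD.mono fun v _ => hall v)


lemma measurable_closedSimplex [Countable V] (s : Finset V) :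
    MeasurableSet (closedSimplex s : Set (V → ℝ)) :=
  (isClosed_closedSimplex s).measurableSet

lemma measurableSet_tangentCone [Countable V] (s : Finset V) :
    MeasurableSet {p : (V → ℝ) × (V → ℝ) | p.2 ∈ tangentCone s p.1} := by
  have e : {p : (V → ℝ) × (V → ℝ) | p.2 ∈ tangentCone s p.1} =
      ((⋂ v, ⋂ _ : v ∉ s, {p | p.2 v = 0}) ∩ {p | ∑ v ∈ s, p.2 v = 0}) ∩
        ⋂ v, ⋂ _ : v ∈ s, ({p | p.1 v = 0}ᶜ ∪ {p | 0 ≤ p.2 v}) := by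
    ext p
    simp [tangentCone, IsTangent, imp_iff_not_or]
  rw [e]
  have m1 : ∀ v, Measurable fun p : (V → ℝ) × (V → ℝ) => p.1 v :=
    fun v => (measurable_pi_apply v).comp measurable_fst
  have m2 : ∀ v, Measurable fun p : (V → ℝ) × (V → ℝ) => p.2 v :=
    fun v => (measurable_pi_apply v).comp measurable_snd
  refine ((MeasurableSet.iInter fun v => MeasurableSet.iInter fun _ =>
    measurableSet_eq_fun (m2 v) measurable_const).inter
    (measurableSet_eq_fun (Finset.measurable_sum _ fun v _ => m2 v) measurable_const)).inter
    (MeasurableSet.iInter fun v => MeasurableSet.iInter fun _ =>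
      (measurableSet_eq_fun (m1 v) measurable_const).compl.union
        (measurableSet_le measurable_const (m2 v)))

lemma measurableSet_sphereBundle : MeasurableSet K.sphereBundle := by
  have := K.countable_vertices
  have e : K.sphereBundle = ⋃ s ∈ K.faces, {p : (V → ℝ) × (V → ℝ) |
      p.1 ∈ closedSimplex s ∧ p.2 ∈ tangentCone s p.1 ∧ K.inner s p.1 p.2 p.2 = 1} := by
    ext p; simp only [sphereBundle, mem_iUnion, exists_prop, mem_ofPred_eq]
  rw [e]
  refine MeasurableSet.biUnion (to_countable _) fun s hs => ?_
  have hc := measurable_closedSimplex (V := V) s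
  have h1 : Measurable fun p : ↥(closedSimplex s) × (V → ℝ) =>
      K.inner s p.1 p.2 p.2 :=
    ((K.continuous_inner hs).comp (f := fun p : ↥(closedSimplex s) × (V → ℝ) =>
      (p.1, p.2, p.2)) (by fun_prop)).measurable
  have h2 : MeasurableSet {p : ↥(closedSimplex s) × (V → ℝ) |
      p.2 ∈ tangentCone s p.1.1 ∧ K.inner s p.1 p.2 p.2 = 1} := by
    refine MeasurableSet.inter ?_ (h1 (measurableSet_singleton 1))
    exact (measurableSet_tangentCone s).preimage
      (f := fun p : ↥(closedSimplex s) × (V → ℝ) => (p.1.1, p.2)) (by fun_prop)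
  have h3 := ((MeasurableEmbedding.subtype_coe hc).prodMap
    (MeasurableEmbedding.id (α := V → ℝ))).measurableSet_image' h2
  convert h3 using 1
  ext p
  constructor
  · rintro ⟨a, b, c⟩
    exact ⟨(⟨p.1, a⟩, p.2), ⟨b, c⟩, rfl⟩
  · rintro ⟨q, ⟨b, c⟩, rfl⟩
    exact ⟨q.1.2, b, c⟩

lemma measurableSet_coneBall (s : K.Top) :
    MeasurableSet {p : ↥(closedSimplex s.1) × (Fin n → ℝ) |
      p.2 ∈ K.coneBall s p.1} := by
  have := K.countable_vertices
  refine MeasurableSet.inter ?_ (MeasurableSet.inter ?_ ?_)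
  · refine (measurableSet_tangentCone s.1).preimage
      (f := fun p : ↥(closedSimplex s.1) × (Fin n → ℝ) =>
        (p.1.1, K.tangentVec s p.2)) ?_
    exact (measurable_subtype_coe.comp measurable_fst).prodMk
      ((K.continuous_tangentVec s).measurable.comp measurable_snd)
  · exact measurableSet_lt measurable_const (K.continuous_lengthSq s).measurable
  · exact measurableSet_le (K.continuous_lengthSq s).measurable measurable_const

lemma measurable_direction (s : K.Top) :
    Measurable fun p : ↥(closedSimplex s.1) × (Fin n → ℝ) =>
      K.direction s p.1 p.2 := by
  have := K.countable_vertices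
  refine (measurable_subtype_coe.comp measurable_fst).prodMk ?_
  exact ((K.continuous_lengthSq s).measurable.sqrt.inv).smul
    ((K.continuous_tangentVec s).measurable.comp measurable_snd)

lemma measurable_direction' (s : K.Top) {x : V → ℝ} (hx : x ∈ closedSimplex s.1) :
    Measurable (K.direction s x) :=
  (K.measurable_direction s).comp (measurable_prodMk_left (x := (⟨x, hx⟩ : ↥(closedSimplex s.1))))

lemma measurableSet_coneBall' (s : K.Top) {x : V → ℝ} (hx : x ∈ closedSimplex s.1) :
    MeasurableSet (K.coneBall s x) :=
  (K.measurableSet_coneBall s).preimage (measurable_prodMk_left (x := (⟨x, hx⟩ : ↥(closedSimplex s.1))))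

lemma measurable_linkMeasure : Measurable K.linkMeasure := by
  have := K.countable_vertices
  classical
  refine Measure.measurable_of_measurable_coe _ fun A hA => ?_
  simp only [linkMeasure, Measure.sum_apply _ hA]
  refine Measurable.tsum fun s => ?_
  have hc := measurable_closedSimplex (V := V) s.1
  have h1 : Measurable fun x : ↥(closedSimplex s.1) =>
      ENNReal.ofReal (√(K.gram s x).det) * volume {u | (x, u) ∈
        {p : ↥(closedSimplex s.1) × (Fin n → ℝ) | p.2 ∈ K.coneBall s p.1} ∩
        (fun p => K.direction s p.1 p.2) ⁻¹' A} := by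
    refine Measurable.mul ?_ (measurable_measure_prodMk_left
      ((K.measurableSet_coneBall s).inter (K.measurable_direction s hA)))
    refine (Real.continuous_sqrt.comp ?_).measurable.ennreal_ofReal
    refine Continuous.matrix_det ?_
    refine continuous_matrix fun i j => ?_
    exact (K.continuous_inner s.2.1).comp
      (f := fun p : ↥(closedSimplex s.1) =>
        (p, K.tangentVec s (Pi.single i 1), K.tangentVec s (Pi.single j 1)))
      (by fun_prop)
  have h2 := Measurable.dite (s := closedSimplex s.1) h1
    (g := fun _ => (0 : ℝ≥0∞)) measurable_const hc
  convert h2 using 2 with x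
  split_ifs with h
  · rw [Measure.smul_apply, smul_eq_mul, Measure.map_apply (K.measurable_direction' s h) hA,
      Measure.restrict_apply (K.measurable_direction' s h hA), inter_comm]
    rfl
  · simp

lemma linkMeasure_univ_pos (x : K.Space) : 0 < K.linkMeasure x.1 univ := by
  obtain ⟨s, hs⟩ := K.exists_mem_top x
  rw [linkMeasure, Measure.sum_apply _ MeasurableSet.univ]
  refine lt_of_lt_of_le ?_ (ENNReal.le_tsum s)
  rw [if_pos hs, Measure.smul_apply, smul_eq_mul,
    Measure.map_apply (K.measurable_direction' s hs) MeasurableSet.univ]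
  simp only [preimage_univ, Measure.restrict_apply_univ]
  exact ENNReal.mul_pos
    (ENNReal.ofReal_pos.2 (Real.sqrt_pos.2 (K.det_gram_pos s hs))).ne'
    (K.volume_coneBall_pos s hs).ne'

lemma linkMeasure_univ_lt_top (x : K.Space) : K.linkMeasure x.1 univ < ∞ := by
  rw [linkMeasure, Measure.sum_apply _ MeasurableSet.univ,
    tsum_eq_sum (s := (K.finite_top x).toFinset) (fun s hs => by
      rw [if_neg (by simpa using hs)]; simp)]
  refine ENNReal.sum_lt_top.2 fun s hs => ?_
  have hs' : x.1 ∈ closedSimplex s.1 := by simpa using hs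
  rw [if_pos hs', Measure.smul_apply, smul_eq_mul,
    Measure.map_apply (K.measurable_direction' s hs') MeasurableSet.univ]
  simp only [preimage_univ, Measure.restrict_apply_univ]
  exact ENNReal.mul_lt_top ENNReal.ofReal_lt_top (K.volume_coneBall_lt_top s hs')

lemma linkMeasure_compl (x : V → ℝ) : K.linkMeasure x K.sphereBundleᶜ = 0 := by
  have hm := K.measurableSet_sphereBundle.compl
  rw [linkMeasure, Measure.sum_apply _ hm, ENNReal.tsum_eq_zero]
  intro s
  split_ifs with h
  · rw [Measure.smul_apply, smul_eq_mul, Measure.map_apply (K.measurable_direction' s h) hm,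
      Measure.restrict_apply (K.measurable_direction' s h hm)]
    have : K.direction s x ⁻¹' K.sphereBundleᶜ ∩ K.coneBall s x = ∅ := by
      ext u
      simp only [mem_inter_iff, mem_preimage, mem_compl_iff, mem_empty_iff_false, iff_false,
        not_and]
      exact fun h1 h2 => h1 (K.direction_mem s h h2)
    rw [this]; simp
  · simp

instance isProbabilityMeasure_uniformMeasure (x : K.Space) :
    IsProbabilityMeasure (K.uniformMeasure x) := by
  have := K.countable_vertices
  refine ⟨?_⟩
  rw [uniformMeasure, (MeasurableEmbedding.subtype_coe K.measurableSet_sphereBundle).comap_apply,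
    image_univ, Subtype.range_coe, Measure.smul_apply, smul_eq_mul]
  have h : K.linkMeasure x.1 K.sphereBundle = K.linkMeasure x.1 univ := by
    rw [← measure_add_measure_compl K.measurableSet_sphereBundle, K.linkMeasure_compl, add_zero]
  rw [h]
  exact ENNReal.inv_mul_cancel (K.linkMeasure_univ_pos x).ne' (K.linkMeasure_univ_lt_top x).ne

lemma measurable_uniformMeasure : Measurable K.uniformMeasure := by
  have he := MeasurableEmbedding.subtype_coe K.measurableSet_sphereBundle
  refine Measure.measurable_of_measurable_coe _ fun A hA => ?_
  have h1 : ∀ B, MeasurableSet B → Measurable fun x : K.Space => K.linkMeasure x.1 B :=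
    fun B hB => (Measure.measurable_coe hB).comp
      (K.measurable_linkMeasure.comp measurable_subtype_coe)
  simp only [uniformMeasure, he.comap_apply, Measure.smul_apply, smul_eq_mul]
  exact (h1 _ MeasurableSet.univ).inv.mul (h1 _ (he.measurableSet_image' hA))

end Aux

/-! ### Generalized geodesics -/

/-- On the interval `I`, the curve `γ` with velocity `c` is a geodesic of the simplex `s`: it stays
in `s` and satisfies the geodesic equation, written as the Euler-Lagrange equation
`d/dt g(γ)(γ', w) = (1/2) (D_w g)(γ)(γ', γ')`, for all `w` tangent to `s`, of the energy. -/
def IsGeodesicOn (s : Finset V) (γ : ℝ → K.Space) (c : ℝ → V → ℝ) (I : Set ℝ) : Prop :=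
  ∀ t ∈ I, (γ t).1 ∈ closedSimplex s ∧ IsTangent s (c t) ∧
    HasDerivWithinAt (fun r => s.restrict (γ r).1) (s.restrict (c t)) I t ∧
    ∀ w : s → ℝ, ∑ i, w i = 0 →
      HasDerivWithinAt (fun r => K.metric s (s.restrict (γ r).1) (s.restrict (c r)) w)
        (1 / 2 * (fderiv ℝ (K.metric s) (s.restrict (γ t).1) w)
          (s.restrict (c t)) (s.restrict (c t))) I t

/-- `ν` is the unit normal at `x` of the face `r` of `s` that points into `s`. -/
def IsInnerNormal (r s : Finset V) (x ν : V → ℝ) : Prop :=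
  IsTangent s ν ∧ (∀ w, IsTangent r w → K.inner s x ν w = 0) ∧ K.inner s x ν ν = 1 ∧
    ∀ v ∈ s, v ∉ r → 0 < ν v

/-- The curve leaves its initial point with velocity `w`, as a geodesic of some `n`-simplex whose
interior it enters at once. -/
def StartsAlong (γ : ℝ → K.Space) (w : V → ℝ) : Prop :=
  ∃ s : K.Top, ∃ ε > 0, ∃ c, K.IsGeodesicOn s.1 γ c (Icc 0 ε) ∧ c 0 = w ∧
    ∀ q ∈ Ioc 0 ε, (γ q).1 ∈ openSimplex s.1

/-- Around the time `t` the curve is a geodesic in the interior of an `n`-simplex. -/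
def IsInteriorTime (γ : ℝ → K.Space) (t : ℝ) : Prop :=
  ∃ s : K.Top, ∃ ε > 0, ∃ c, K.IsGeodesicOn s.1 γ c (Ioo (t - ε) (t + ε)) ∧
    ∀ q ∈ Ioo (t - ε) (t + ε), (γ q).1 ∈ openSimplex s.1

/-- At the time `t` the curve crosses transversally the interior of an `(n-1)`-simplex `r`: it
arrives as a geodesic of an `n`-simplex `s` and leaves as a geodesic of another `n`-simplex `s'`
adjacent to `r`. The velocity `u - a ν` of arrival (`u` tangent to `r`, `a > 0`, `ν` the inner
normal of `r` in `s`) is continued by the velocity `u + a ν'` (`ν'` the inner normal of `r`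
in `s'`). -/
def IsCrossingTime (γ : ℝ → K.Space) (t : ℝ) : Prop :=
  ∃ r ∈ K.faces, r.card = n ∧ (γ t).1 ∈ openSimplex r ∧
    ∃ s s' : K.Top, r ⊆ s.1 ∧ r ⊆ s'.1 ∧ s ≠ s' ∧ ∃ ε > 0, ∃ c c' : ℝ → V → ℝ,
      K.IsGeodesicOn s.1 γ c (Icc (t - ε) t) ∧
      (∀ q ∈ Ico (t - ε) t, (γ q).1 ∈ openSimplex s.1) ∧
      K.IsGeodesicOn s'.1 γ c' (Icc t (t + ε)) ∧
      (∀ q ∈ Ioc t (t + ε), (γ q).1 ∈ openSimplex s'.1) ∧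
      ∃ (u ν ν' : V → ℝ) (a : ℝ), 0 < a ∧ IsTangent r u ∧
        K.IsInnerNormal r s.1 (γ t).1 ν ∧ K.IsInnerNormal r s'.1 (γ t).1 ν' ∧
        c t = u - a • ν ∧ c' t = u + a • ν'

/-- On the time interval `[0, ζ)` (on `{0}` if `ζ = 0`), `γ` is a generalized geodesic with initial
point and velocity `z`. -/
def IsGeneralizedGeodesic (z : K.Sphere) (ζ : ℝ≥0∞) (γ : ℝ → K.Space) : Prop :=
  γ 0 = K.base z ∧ (0 < ζ → K.StartsAlong γ z.1.2) ∧
    ∀ t : ℝ, 0 < t → ENNReal.ofReal t < ζ → K.IsInteriorTime γ t ∨ K.IsCrossingTime γ t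

/-- `γ` is a generalized geodesic on `[0, ζ)` that has no continuation beyond `ζ`. -/
def IsMaximalGeodesic (z : K.Sphere) (ζ : ℝ≥0∞) (γ : ℝ → K.Space) : Prop :=
  K.IsGeneralizedGeodesic z ζ γ ∧ ∀ ζ' γ', K.IsGeneralizedGeodesic z ζ' γ' →
    (∀ t : ℝ, 0 ≤ t → ENNReal.ofReal t < ζ → γ' t = γ t) → ζ' ≤ ζ

/-- The one-point compactification carries its Borel `σ`-algebra. -/
instance borelOnePoint {E : Type*} [TopologicalSpace E] : MeasurableSpace (OnePoint E) := borel _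

instance borelSpaceOnePoint {E : Type*} [TopologicalSpace E] : BorelSpace (OnePoint E) := ⟨rfl⟩

/-- A generalized geodesic flow, projected to the complex: a measurable choice, for each element
`z = (x, w)` of the space of links, of a maximal generalized geodesic `t ↦ X_z(t)` starting from
`x` with velocity `w` (at each crossing of an `(n-1)`-simplex one of the adjacent `n`-simplices has
to be chosen). Beyond its maximal interval of existence, the trajectory is at the cemetery `∞`. -/
structure GeodesicFlow where
  toFun : K.Sphere → ℝ≥0 → OnePoint K.Space
  measurable_toFun : Measurable (Function.uncurry toFun)
  exists_geodesic : ∀ z, ∃ ζ γ, K.IsMaximalGeodesic z ζ γ ∧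
    ∀ t : ℝ≥0, ((t = 0 ∨ (t : ℝ≥0∞) < ζ) → toFun z t = ((γ t : K.Space) : OnePoint K.Space)) ∧
      (¬ (t = 0 ∨ (t : ℝ≥0∞) < ζ) → toFun z t = OnePoint.infty)

/-! ### The isotropic transport process -/

lemma measurable_onePoint {E F G : Type*} [TopologicalSpace E] [T1Space E] [MeasurableSpace E]
    [BorelSpace E] [MeasurableSpace F] [MeasurableSpace G] {f : OnePoint E × G → F}
    (hf : Measurable fun p : E × G => f (p.1, p.2))
    (hi : Measurable fun y : G => f (OnePoint.infty, y)) : Measurable f := by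
  intro A hA
  have he : MeasurableEmbedding (OnePoint.some : E → OnePoint E) :=
    OnePoint.isOpenEmbedding_coe.measurableEmbedding
  have h1 := (he.prodMap (MeasurableEmbedding.id (α := G))).measurableSet_image' (hf hA)
  have h2 : f ⁻¹' A = Prod.map (OnePoint.some : E → OnePoint E) id ''
      ((fun p : E × G => f (p.1, p.2)) ⁻¹' A) ∪
      ({OnePoint.infty} ×ˢ ((fun y : G => f (OnePoint.infty, y)) ⁻¹' A)) := by
    ext ⟨p, y⟩
    cases p using OnePoint.rec with
    | infty => simp
    | coe x => simp
  rw [h2]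
  exact h1.union ((measurableSet_singleton _).prod (hi hA))

/-- The uniform measures on the links, as a Markov kernel; for the cemetery it is the Dirac mass at
the cemetery. -/
def linkKernel : Kernel (OnePoint K.Space) (OnePoint K.Sphere) where
  toFun p := p.elim (Measure.dirac OnePoint.infty) fun x => (K.uniformMeasure x).map OnePoint.some
  measurable' := by
    have := K.countable_vertices
    let f : OnePoint K.Space → Measure (OnePoint K.Sphere) := fun p =>
      p.elim (Measure.dirac OnePoint.infty) fun x => (K.uniformMeasure x).map OnePoint.some
    have h : Measurable fun p : OnePoint K.Space × Unit => f p.1 :=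
      measurable_onePoint (((Measure.measurable_map _
        OnePoint.isOpenEmbedding_coe.measurableEmbedding.measurable).comp
          K.measurable_uniformMeasure).comp measurable_fst) measurable_const
    exact h.comp (measurable_id.prodMk (measurable_const (a := ())))

instance isMarkovKernel_linkKernel : IsMarkovKernel K.linkKernel := by
  have := K.countable_vertices
  refine ⟨fun p => ?_⟩
  cases p using OnePoint.rec with
  | infty =>
    exact (inferInstance :
      IsProbabilityMeasure (Measure.dirac (OnePoint.infty : OnePoint K.Sphere)))
  | coe x =>
    exact Measure.isProbabilityMeasure_map
      OnePoint.isOpenEmbedding_coe.measurableEmbedding.measurable.aemeasurable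

namespace GeodesicFlow

variable {K} (X : K.GeodesicFlow)

/-- The position at time `t` on the trajectory of `z`, with the cemetery as a trap. -/
def position (z : OnePoint K.Sphere) (t : ℝ≥0) : OnePoint K.Space :=
  z.elim OnePoint.infty fun z => X.toFun z t

lemma measurable_position : Measurable fun p : OnePoint K.Sphere × ℝ≥0 => X.position p.1 p.2 := by
  have := K.countable_vertices
  exact measurable_onePoint X.measurable_toFun measurable_const

/-- The exponential law with parameter one, as a measure on `[0, ∞)`. -/
def waitingTime : Measure ℝ≥0 := (expMeasure 1).map Real.toNNReal

instance isProbabilityMeasure_waitingTime : IsProbabilityMeasure waitingTime := by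
  have := isProbabilityMeasure_expMeasure one_pos
  exact Measure.isProbabilityMeasure_map measurable_real_toNNReal.aemeasurable

/-- The transition kernel of the Markov chain `(Z_k, τ_k)`: from `(z, t)`, after an exponential
waiting time `u`, the chain jumps to `(z', t + u)`, where `z'` is chosen uniformly in the link over
the point `X_z(u)` reached along the trajectory of `z`. -/
def transition : Kernel (OnePoint K.Sphere × ℝ≥0) (OnePoint K.Sphere × ℝ≥0) :=
  (Kernel.id ×ₖ ((Kernel.const _ waitingTime) ⊗ₖ
    (K.linkKernel.comap (fun p : (OnePoint K.Sphere × ℝ≥0) × ℝ≥0 => X.position p.1.1 p.2)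
      (X.measurable_position.comp (((measurable_fst.comp measurable_fst)).prodMk
        measurable_snd))))).map
    fun q => (q.2.2, q.1.2 + q.2.1)

instance isMarkovKernel_transition : IsMarkovKernel X.transition :=
  Kernel.IsMarkovKernel.map _ ((measurable_snd.comp measurable_snd).prodMk
    ((measurable_snd.comp measurable_fst).add (measurable_fst.comp measurable_snd)))

lemma transition_apply (z : OnePoint K.Sphere) (t : ℝ≥0) {A : Set (OnePoint K.Sphere × ℝ≥0)}
    (hA : MeasurableSet A) :
    X.transition (z, t) A =
      ∫⁻ u, K.linkKernel (X.position z u) {z' | (z', t + u) ∈ A} ∂waitingTime := by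
  have hm : Measurable fun q : (OnePoint K.Sphere × ℝ≥0) × (ℝ≥0 × OnePoint K.Sphere) =>
      (q.2.2, q.1.2 + q.2.1) := (measurable_snd.comp measurable_snd).prodMk
    ((measurable_snd.comp measurable_fst).add (measurable_fst.comp measurable_snd))
  rw [transition, Kernel.map_apply' _ hm _ hA, Kernel.prod_apply, Kernel.id_apply,
    Measure.dirac_prod, Measure.map_apply measurable_prodMk_left (hm hA),
    Kernel.compProd_apply (measurable_prodMk_left (hm hA)), Kernel.const_apply]
  rfl

/-- The law `P^x` of the chain `(Z_k, τ_k)` started with `τ_0 = 0` and with `Z_0` uniform in the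
link of `x`, on the space of sequences. -/
def law (x : K.Space) : Measure (ℕ → OnePoint K.Sphere × ℝ≥0) :=
  Kernel.trajMeasure (X := fun _ => OnePoint K.Sphere × ℝ≥0)
    ((K.linkKernel x).prod (Measure.dirac 0))
    fun k => X.transition.comap (fun h => h ⟨k, Finset.mem_Iic.2 le_rfl⟩)
      (measurable_pi_apply _)

instance isProbabilityMeasure_law (x : K.Space) : IsProbabilityMeasure (X.law x) := by
  unfold law; infer_instance

/-- The isotropic transport process `Y_t`: it follows the trajectory of `Z_i` from the time `τ_i`
to the time `τ_{i+1}`, and is at the cemetery after all the `τ_i`. -/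
def process (t : ℝ≥0) (ω : ℕ → OnePoint K.Sphere × ℝ≥0) : OnePoint K.Space := by
  classical
  exact if h : ∃ i, (ω i).2 ≤ t ∧ t < (ω (i + 1)).2 then
    X.position (ω (Nat.find h)).1 (t - (ω (Nat.find h)).2)
  else OnePoint.infty

/-- Functions on the complex are extended by zero to the cemetery. -/
def extend (f : K.Space → ℝ) (p : OnePoint K.Space) : ℝ := p.elim 0 f

/-- `T⁰_t f(x)`, the average of `f(X_{(x, η)}(t))` over the uniformly distributed directions `η`. -/
def averaged (t : ℝ≥0) (f : K.Space → ℝ) (x : K.Space) : ℝ :=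
  ∫ z, extend f (X.toFun z t) ∂K.uniformMeasure x

/-- `T_t f(x) = E^x[f(Y_t)]`. -/
def expectation (t : ℝ≥0) (f : K.Space → ℝ) (x : K.Space) : ℝ :=
  ∫ ω, extend f (X.process t ω) ∂X.law x

/-- `R⁰_lam f(x)`, the resolvent of the operators `T⁰_t`. -/
def averagedResolvent (lam : ℝ) (f : K.Space → ℝ) (x : K.Space) : ℝ :=
  ∫ t in Ioi (0 : ℝ), Real.exp (-lam * t) * X.averaged t.toNNReal f x

/-- `R_lam f(x)`, the resolvent of the operators `T_t`. -/
def resolvent (lam : ℝ) (f : K.Space → ℝ) (x : K.Space) : ℝ :=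
  ∫ t in Ioi (0 : ℝ), Real.exp (-lam * t) * X.expectation t.toNNReal f x

end GeodesicFlow

end RiemannianComplex

end TransportProcess

end

noncomputable section

namespace TransportProcess

/-! Cut the time axis at the jump times. Between the jumps `k` and `k + 1` the process follows the
single trajectory of `Z_k`, so the resolvent is the sum over `k` of the discounted integrals of `f`
over these intervals. Nothing else contributes: outside them the process is at the cemetery, where
`f` is zero, so it never has to be shown that the jump times tend to infinity.

Write `G f (z)` for `pathResolvent (lam + 1) f z`. Given `(Z_k, τ_k)`, the `k`-th interval
contributes `e^{-lam τ_k} G f (Z_k)`: the discount `e^{-lam s}` is multiplied by the probability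
`e^{-s}` that no jump has occurred after a time `s` (`integral_transition_integral_expWeight`). The
same product of exponentials, with `e^{-u}` now the density of the waiting time, shows that one
transition turns `e^{-lam τ} G f (Z)` into `e^{-lam τ} G (R⁰ f) (Z)`, where `R⁰` is
`averagedResolvent (lam + 1)` (`integral_exp_mul_pathResolvent_transition`). As `R⁰ f (x)` is the
mean of `G f` over the link of `x`, induction on `k` gives the value `(R⁰)^{k+1} f (x)` for the
`k`-th contribution (`integral_jumpTerm`).

Each `R⁰` costs a factor `1 / (lam + 1) < 1` in sup norm. This geometric bound, applied to `|f|`,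
permits the exchange of sum and integral (`hasSum_resolvent`); applied to `f`, it gives uniform
convergence by the Weierstrass test. -/

/-! ### Exponential weights on the half-line -/

/-- The measure `e^{-a t} dt` on `[0, ∞)`. -/
def expWeight (a : ℝ) : Measure ℝ≥0 :=
  ((volume.restrict (Ioi (0 : ℝ))).withDensity fun t => ENNReal.ofReal (Real.exp (-a * t))).map
    Real.toNNReal

/-- Passes from the integrals over `Ioi 0` that define the resolvents to a measure on `ℝ≥0`, the
time of the flow. For `a > 0` this measure is finite, so bounded measurable functions are integrable
and Fubini applies at once. -/
lemma integral_expWeight (a : ℝ) {g : ℝ≥0 → ℝ} (hg : Measurable g) :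
    ∫ t, g t ∂expWeight a = ∫ t in Ioi (0 : ℝ), Real.exp (-a * t) * g t.toNNReal := by
  rw [expWeight, integral_map measurable_real_toNNReal.aemeasurable hg.aestronglyMeasurable,
    integral_withDensity_eq_integral_toReal_smul (by fun_prop) (by simp)]
  simp [ENNReal.toReal_ofReal (Real.exp_pos _).le]

lemma integrableOn_exp_mul_iff (a : ℝ) {g : ℝ≥0 → ℝ} (hg : Measurable g) :
    IntegrableOn (fun t : ℝ => Real.exp (-a * t) * g t.toNNReal) (Ioi 0) ↔
      Integrable g (expWeight a) := by
  rw [expWeight, integrable_map_measure hg.aestronglyMeasurable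
    measurable_real_toNNReal.aemeasurable,
    integrable_withDensity_iff_integrable_smul' (by fun_prop) (by simp)]
  simp [IntegrableOn, ENNReal.toReal_ofReal (Real.exp_pos _).le]

lemma isFiniteMeasure_expWeight {a : ℝ} (ha : 0 < a) : IsFiniteMeasure (expWeight a) := by
  have h : Integrable (fun _ => (1 : ℝ)) (expWeight a) := by
    rw [← integrableOn_exp_mul_iff a measurable_const]
    simpa using integrableOn_exp_mul_Ioi (neg_lt_zero.2 ha) 0
  simpa [integrable_const_iff] using h

lemma expWeight_real_univ {a : ℝ} (ha : 0 < a) : (expWeight a).real univ = 1 / a := by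
  have h := integral_expWeight a (g := fun _ => 1) measurable_const
  simp only [mul_one] at h
  rw [integral_exp_mul_Ioi (neg_lt_zero.2 ha)] at h
  simpa [neg_div_neg_eq] using h

/-- Puts the waiting time and the discount in one family of measures, so that they can be merged.
The densities differ only at the null point `0`. -/
lemma waitingTime_eq_expWeight :
    RiemannianComplex.GeodesicFlow.waitingTime = expWeight 1 := by
  rw [RiemannianComplex.GeodesicFlow.waitingTime, expWeight]
  congr 1
  rw [expMeasure, gammaMeasure, restrict_Ioi_eq_restrict_Ici,
    ← withDensity_indicator measurableSet_Ici]
  congr 1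
  ext t
  change exponentialPDF 1 t = _
  rw [exponentialPDF_eq]
  by_cases ht : 0 ≤ t <;> simp [ht]

/-- Substitute `t = s + r` and split the exponential: starting at the time `r` costs the factor
`e^{-a r}`. Every step is an identity of Bochner integrals, so no integrability is required. -/
lemma integral_expWeight_shift (a : ℝ) (r : ℝ≥0) {g : ℝ≥0 → ℝ} (hg : Measurable g) :
    ∫ t, (if r ≤ t then g (t - r) else 0) ∂expWeight a =
      Real.exp (-a * r) * ∫ t, g t ∂expWeight a := by
  rw [integral_expWeight a (Measurable.ite measurableSet_Ici (by fun_prop) measurable_const),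
    integral_expWeight a hg, ← integral_const_mul]
  have h1 : ∀ t ∈ Ioi (0 : ℝ), Real.exp (-a * t) *
      (if r ≤ t.toNNReal then g (t.toNNReal - r) else 0) =
      (Ici (r : ℝ)).indicator (fun t => Real.exp (-a * t) * g (t - r).toNNReal) t := by
    intro t ht
    have e : r ≤ t.toNNReal ↔ (r : ℝ) ≤ t := Real.le_toNNReal_iff_coe_le (le_of_lt ht)
    by_cases h : (r : ℝ) ≤ t
    · rw [if_pos (e.2 h), indicator_of_mem (mem_Ici.2 h), NNReal.sub_def,
        Real.coe_toNNReal t (le_of_lt ht)]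
    · rw [if_neg (mt e.1 h), indicator_of_notMem (mt mem_Ici.1 h), mul_zero]
  rw [setIntegral_congr_fun measurableSet_Ioi h1, setIntegral_indicator measurableSet_Ici]
  -- The endpoint is dropped so that the preimage of the domain under `t ↦ t + r` is exactly `Ioi
  -- 0`.
  have h2 : (Ioi (0 : ℝ) ∩ Ici (r : ℝ) : Set ℝ) =ᵐ[volume] Ioi (r : ℝ) := by
    have : (Ioi (0 : ℝ) ∩ Ioi (r : ℝ) : Set ℝ) = Ioi (r : ℝ) :=
      inter_eq_right.2 (Ioi_subset_Ioi r.coe_nonneg)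
    rw [← this]
    exact (ae_eq_refl _).inter Ioi_ae_eq_Ici.symm
  rw [setIntegral_congr_set h2]
  rw [← (measurePreserving_add_right volume (r : ℝ)).setIntegral_preimage_emb
    (measurableEmbedding_addRight (r : ℝ)) _ (Ioi (r : ℝ))]
  simp only [preimage_add_const_Ioi, sub_self]
  refine integral_congr_ae (Eventually.of_forall fun t => ?_)
  simp only [add_sub_cancel_right, mul_add, Real.exp_add]
  ring

/-- The source of the parameter `lam + 1`: it is used with `{a, b} = {lam, 1}`, in both orders. -/
lemma integral_exp_mul_expWeight (a b : ℝ) {g : ℝ≥0 → ℝ} (hg : Measurable g) :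
    ∫ t, Real.exp (-b * t) * g t ∂expWeight a = ∫ t, g t ∂expWeight (a + b) := by
  rw [integral_expWeight a (by fun_prop), integral_expWeight _ hg]
  refine setIntegral_congr_fun measurableSet_Ioi fun t ht => ?_
  simp only [Real.coe_toNNReal t (le_of_lt ht)]
  rw [← mul_assoc, ← Real.exp_add]
  ring_nf

/-- The probability that the waiting time exceeds `s`. -/
lemma expWeight_one_real_Ioi (s : ℝ≥0) : (expWeight 1).real (Ioi s) = Real.exp (-s) := by
  have h := integral_expWeight 1 (g := (Ioi s).indicator 1)
    (measurable_one.indicator measurableSet_Ioi)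
  rw [integral_indicator_one measurableSet_Ioi] at h
  rw [h, ← integral_exp_neg_Ioi]
  have h1 : ∀ t : ℝ, Real.exp (-1 * t) * (Ioi s).indicator 1 t.toNNReal =
      (Ioi (s : ℝ)).indicator (fun t => Real.exp (-t)) t := by
    intro t
    by_cases ht : (s : ℝ) < t
    · have : s < t.toNNReal := Real.lt_toNNReal_iff_coe_lt.2 ht
      simp [ht, this]
    · have : ¬ s < t.toNNReal := mt Real.lt_toNNReal_iff_coe_lt.1 ht
      simp [ht, this]
  simp only [h1]
  rw [setIntegral_indicator measurableSet_Ioi, inter_eq_right.2 (Ioi_subset_Ioi s.coe_nonneg)]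

lemma abs_integral_le_of_abs_le {α : Type*} [MeasurableSpace α] {μ : Measure α} {g : α → ℝ}
    [IsFiniteMeasure μ] {C : ℝ} (h : ∀ a, |g a| ≤ C) : |∫ a, g a ∂μ| ≤ C * μ.real univ :=
  norm_integral_le_of_norm_le_const (f := g) (Eventually.of_forall h)

namespace RiemannianComplex

variable {V : Type*} {n : ℕ} {K : RiemannianComplex V n}

namespace GeodesicFlow

/-! ### Extension by zero to the cemetery -/

lemma extend_coe (f : K.Space → ℝ) (x : K.Space) : extend f (x : OnePoint K.Space) = f x := rfl

lemma extend_infty (f : K.Space → ℝ) : extend f (OnePoint.infty : OnePoint K.Space) = 0 := rfl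

lemma measurable_coe_space : Measurable (OnePoint.some : K.Space → OnePoint K.Space) := by
  have := K.countable_vertices
  exact OnePoint.isOpenEmbedding_coe.measurableEmbedding.measurable

lemma measurable_coe_sphere : Measurable (OnePoint.some : K.Sphere → OnePoint K.Sphere) := by
  have := K.countable_vertices
  exact OnePoint.isOpenEmbedding_coe.measurableEmbedding.measurable

lemma measurable_extend {f : K.Space → ℝ} (hf : Measurable f) :
    Measurable (extend f : OnePoint K.Space → ℝ) := by
  have := K.countable_vertices
  exact (measurable_onePoint (f := fun p : OnePoint K.Space × Unit => extend f p.1)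
    (hf.comp measurable_fst) measurable_const).comp
      (measurable_id.prodMk (measurable_const (a := ())))

/-- A connected complex is nonempty. Hence a bound for `f` also bounds the value zero at the
cemetery. -/
lemma nonneg_of_abs_le {f : K.Space → ℝ} {C : ℝ} (hC : ∀ x, |f x| ≤ C) : 0 ≤ C := by
  obtain ⟨x, hx⟩ := K.connected.nonempty
  exact (abs_nonneg _).trans (hC ⟨x, hx⟩)

lemma abs_extend_le {f : K.Space → ℝ} {C : ℝ} (hC : ∀ x, |f x| ≤ C) (p : OnePoint K.Space) :
    |extend f p| ≤ C := by
  cases p using OnePoint.rec with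
  | infty => rw [extend_infty, abs_zero]; exact nonneg_of_abs_le hC
  | coe x => exact hC x

lemma abs_extend (f : K.Space → ℝ) (p : OnePoint K.Space) :
    |extend f p| = extend (fun x => |f x|) p := by
  cases p using OnePoint.rec with
  | infty => simp [extend_infty]
  | coe x => rfl

lemma integrable_extend_comp {α : Type*} [MeasurableSpace α] {μ : Measure α} [IsFiniteMeasure μ]
    {f : K.Space → ℝ} (hf : Measurable f) {C : ℝ} (hC : ∀ x, |f x| ≤ C)
    {g : α → OnePoint K.Space} (hg : Measurable g) : Integrable (fun a => extend f (g a)) μ :=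
  .of_bound ((measurable_extend hf).comp hg).aestronglyMeasurable C
    (Eventually.of_forall fun _ => abs_extend_le hC _)

variable (X : K.GeodesicFlow)

lemma position_infty (t : ℝ≥0) : X.position OnePoint.infty t = OnePoint.infty := rfl

lemma linkKernel_coe (x : K.Space) :
    K.linkKernel (x : OnePoint K.Space) = (K.uniformMeasure x).map OnePoint.some := rfl

lemma linkKernel_infty :
    K.linkKernel (OnePoint.infty : OnePoint K.Space) = Measure.dirac OnePoint.infty := rfl

/-! ### The averaged resolvent as a link average of trajectory resolvents -/

/-- The resolvent along a single trajectory: the weighted integral of `f` along the trajectory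
of `z`. -/
def pathResolvent (a : ℝ) (f : K.Space → ℝ) (z : OnePoint K.Sphere) : ℝ :=
  ∫ s, extend f (X.position z s) ∂expWeight a

section Resolvent

variable {f : K.Space → ℝ} {C a : ℝ}

lemma measurable_extend_position (hf : Measurable f) :
    Measurable fun p : OnePoint K.Sphere × ℝ≥0 => extend f (X.position p.1 p.2) :=
  (measurable_extend hf).comp X.measurable_position

lemma measurable_pathResolvent (ha : 0 < a) (hf : Measurable f) :
    Measurable (X.pathResolvent a f) := by
  have := isFiniteMeasure_expWeight ha
  exact (X.measurable_extend_position hf).stronglyMeasurable.integral_prod_right.measurable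

lemma abs_pathResolvent_le (ha : 0 < a) (hC : ∀ x, |f x| ≤ C) (z : OnePoint K.Sphere) :
    |X.pathResolvent a f z| ≤ 1 / a * C := by
  have := isFiniteMeasure_expWeight ha
  rw [← expWeight_real_univ ha, mul_comm]
  exact abs_integral_le_of_abs_le fun s => abs_extend_le hC _

lemma pathResolvent_infty : X.pathResolvent a f OnePoint.infty = 0 := by
  simp [pathResolvent, position_infty, extend_infty]

lemma averaged_eq_integral_linkKernel (hf : Measurable f) (t : ℝ≥0) (x : K.Space) :
    X.averaged t f x = ∫ z, extend f (X.position z t) ∂K.linkKernel x := by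
  have h : Measurable fun z => extend f (X.position z t) :=
    (X.measurable_extend_position hf).comp measurable_prodMk_right
  rw [linkKernel_coe, integral_map measurable_coe_sphere.aemeasurable h.aestronglyMeasurable]
  rfl

lemma measurable_averaged (hf : Measurable f) (x : K.Space) :
    Measurable fun t => X.averaged t f x := by
  simp only [X.averaged_eq_integral_linkKernel hf]
  exact (X.measurable_extend_position hf).stronglyMeasurable.integral_prod_left.measurable

lemma abs_averaged_le (hC : ∀ x, |f x| ≤ C) (t : ℝ≥0) (x : K.Space) :
    |X.averaged t f x| ≤ C := by
  have h := abs_integral_le_of_abs_le (μ := K.uniformMeasure x)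
    fun z => abs_extend_le hC (X.toFun z t)
  rwa [probReal_univ, mul_one] at h

/-- Fubini for the direction and the time. -/
lemma averagedResolvent_eq (ha : 0 < a) (hf : Measurable f) (hC : ∀ x, |f x| ≤ C) (x : K.Space) :
    X.averagedResolvent a f x = ∫ z, X.pathResolvent a f z ∂K.linkKernel x := by
  have := isFiniteMeasure_expWeight ha
  rw [averagedResolvent, ← integral_expWeight a (X.measurable_averaged hf x)]
  simp only [X.averaged_eq_integral_linkKernel hf, pathResolvent]
  exact integral_integral_swap (integrable_extend_comp hf hC
    (X.measurable_position.comp measurable_swap))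

/-- The cemetery is a trap on which `f` vanishes, so both sides are zero there. The chain can then
be integrated without distinguishing whether the trajectory has died before the jump. -/
lemma extend_averagedResolvent (ha : 0 < a) (hf : Measurable f) (hC : ∀ x, |f x| ≤ C)
    (p : OnePoint K.Space) :
    extend (X.averagedResolvent a f) p = ∫ z, X.pathResolvent a f z ∂K.linkKernel p := by
  cases p using OnePoint.rec with
  | infty =>
    rw [linkKernel_infty, integral_dirac' _ _
      (X.measurable_pathResolvent ha hf).stronglyMeasurable, pathResolvent_infty, extend_infty]
  | coe x => rw [extend_coe, X.averagedResolvent_eq ha hf hC]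

lemma measurable_averagedResolvent (ha : 0 < a) (hf : Measurable f) (hC : ∀ x, |f x| ≤ C) :
    Measurable (X.averagedResolvent a f) := by
  have h : X.averagedResolvent a f =
      (fun p => ∫ z, X.pathResolvent a f z ∂K.linkKernel p) ∘ OnePoint.some :=
    funext fun x => X.averagedResolvent_eq ha hf hC x
  rw [h]
  exact ((X.measurable_pathResolvent ha hf).stronglyMeasurable.integral_kernel
    (κ := K.linkKernel)).measurable.comp measurable_coe_space

lemma abs_averagedResolvent_le (ha : 0 < a) (hf : Measurable f) (hC : ∀ x, |f x| ≤ C)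
    (x : K.Space) : |X.averagedResolvent a f x| ≤ 1 / a * C := by
  rw [X.averagedResolvent_eq ha hf hC]
  have h := abs_integral_le_of_abs_le (μ := K.linkKernel x) (X.abs_pathResolvent_le ha hC)
  rwa [probReal_univ, mul_one] at h

/-- Measurability and bound go together in the induction, since the bound for one more iterate uses
the measurability of the previous one. For `a = lam + 1` the bounds are the majorants of the series.
-/
lemma iterate_averagedResolvent (ha : 0 < a) (hf : Measurable f) (hC : ∀ x, |f x| ≤ C) (k : ℕ) :
    Measurable ((X.averagedResolvent a)^[k] f) ∧
      ∀ x, |(X.averagedResolvent a)^[k] f x| ≤ (1 / a) ^ k * C := by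
  induction k with
  | zero => exact ⟨hf, fun x => by simpa using hC x⟩
  | succ k ih =>
    rw [Function.iterate_succ_apply', pow_succ', mul_assoc]
    exact ⟨X.measurable_averagedResolvent ha ih.1 ih.2,
      X.abs_averagedResolvent_le ha ih.1 ih.2⟩

end Resolvent

/-! ### One step of the chain -/

/-- Presents a step as the image of a pair (waiting time, new direction), the form in which
integrals and almost sure statements can be computed. -/
lemma transition_eq_map (p : OnePoint K.Sphere × ℝ≥0) :
    X.transition p = (waitingTime ⊗ₘ (K.linkKernel.comap (X.position p.1)
      (X.measurable_position.comp measurable_prodMk_left))).map fun q => (q.2, p.2 + q.1) := by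
  ext A hA
  have hm : Measurable fun q : ℝ≥0 × OnePoint K.Sphere => (q.2, p.2 + q.1) := by fun_prop
  rw [← Prod.mk.eta (p := p), X.transition_apply _ _ hA, Measure.map_apply hm hA,
    Measure.compProd_apply (hm hA)]
  rfl

lemma integral_transition (p : OnePoint K.Sphere × ℝ≥0) {h : OnePoint K.Sphere × ℝ≥0 → ℝ}
    (hh : Measurable h) {C : ℝ} (hC : ∀ q, |h q| ≤ C) :
    ∫ q, h q ∂X.transition p =
      ∫ u, ∫ z, h (z, p.2 + u) ∂K.linkKernel (X.position p.1 u) ∂waitingTime := by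
  have hm : Measurable fun q : ℝ≥0 × OnePoint K.Sphere => (q.2, p.2 + q.1) := by fun_prop
  rw [transition_eq_map, integral_map hm.aemeasurable hh.aestronglyMeasurable,
    Measure.integral_compProd (f := fun q => h (q.2, p.2 + q.1))
      (.of_bound (hh.comp hm).aestronglyMeasurable C (Eventually.of_forall fun _ => hC _))]
  rfl

lemma ae_transition_le (p : OnePoint K.Sphere × ℝ≥0) : ∀ᵐ q ∂X.transition p, p.2 ≤ q.2 := by
  have hm : Measurable fun q : ℝ≥0 × OnePoint K.Sphere => (q.2, p.2 + q.1) := by fun_prop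
  rw [transition_eq_map, ae_map_iff hm.aemeasurable (measurableSet_le (by fun_prop) (by fun_prop))]
  exact Eventually.of_forall fun q => le_self_add

lemma abs_exp_neg_mul_le {lam : ℝ} (hlam : 0 ≤ lam) (t : ℝ≥0) {y C : ℝ} (hy : |y| ≤ C) :
    |Real.exp (-lam * t) * y| ≤ C := by
  rw [abs_mul, Real.abs_exp]
  have h : Real.exp (-lam * t) ≤ 1 := Real.exp_le_one_iff.2 (by
    have := mul_nonneg hlam t.2
    change -lam * (t : ℝ) ≤ 0
    linarith [show 0 ≤ lam * (t : ℝ) from this])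
  calc _ ≤ 1 * |y| := by gcongr
    _ ≤ C := by rwa [one_mul]

/-- The recursion behind the powers of the resolvent. Averaging over the new direction replaces the
trajectory resolvent of `f` by the averaged resolvent at the point of the jump; the factor `e^{-lam
u}` combines with the law `e^{-u} du` of the waiting time into the weight of parameter `lam + 1`
along the old trajectory. -/
lemma integral_exp_mul_pathResolvent_transition {lam : ℝ} (hlam : 0 < lam) {f : K.Space → ℝ}
    (hf : Measurable f) {C : ℝ} (hC : ∀ x, |f x| ≤ C) (p : OnePoint K.Sphere × ℝ≥0) :
    ∫ q, Real.exp (-lam * q.2) * X.pathResolvent (lam + 1) f q.1 ∂X.transition p =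
      Real.exp (-lam * p.2) * X.pathResolvent (lam + 1) (X.averagedResolvent (lam + 1) f) p.1 := by
  have ha : 0 < lam + 1 := by linarith
  have hG := X.measurable_pathResolvent ha hf
  rw [X.integral_transition p (by fun_prop)
    (fun q => abs_exp_neg_mul_le hlam.le q.2 (X.abs_pathResolvent_le ha hC q.1))]
  simp only [integral_const_mul, ← X.extend_averagedResolvent ha hf hC]
  have hR : Measurable fun s =>
      extend (X.averagedResolvent (lam + 1) f) (X.position p.1 s) :=
    (X.measurable_extend_position (X.measurable_averagedResolvent ha hf hC)).comp
      measurable_prodMk_left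
  have hw := integral_exp_mul_expWeight 1 lam hR
  rw [add_comm 1 lam] at hw
  rw [pathResolvent, ← hw, waitingTime_eq_expWeight, ← integral_const_mul]
  refine integral_congr_ae (Eventually.of_forall fun u => ?_)
  simp only [NNReal.coe_add, mul_add, Real.exp_add]
  ring

/-- The contribution to the resolvent of one jump interval, given the state at its beginning. -/
lemma integral_transition_integral_expWeight {lam : ℝ} (hlam : 0 < lam) {f : K.Space → ℝ}
    (hf : Measurable f) {C : ℝ} (hC : ∀ x, |f x| ≤ C) (p : OnePoint K.Sphere × ℝ≥0) :
    ∫ q, ∫ t, (if p.2 ≤ t ∧ t < q.2 then extend f (X.position p.1 (t - p.2)) else 0)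
        ∂expWeight lam ∂X.transition p =
      Real.exp (-lam * p.2) * X.pathResolvent (lam + 1) f p.1 := by
  have := isFiniteMeasure_expWeight hlam
  have hg : Measurable fun s => extend f (X.position p.1 s) :=
    (X.measurable_extend_position hf).comp measurable_prodMk_left
  have hC0 := nonneg_of_abs_le hC
  have hb : ∀ (P : Prop) [Decidable P] (s : ℝ≥0),
      |if P then extend f (X.position p.1 s) else 0| ≤ C := by
    intro P _ s
    split_ifs
    · exact abs_extend_le hC _
    · simpa using hC0
  have hm : Measurable fun q : (OnePoint K.Sphere × ℝ≥0) × ℝ≥0 =>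
      if p.2 ≤ q.2 ∧ q.2 < q.1.2 then extend f (X.position p.1 (q.2 - p.2)) else 0 :=
    Measurable.ite ((measurableSet_le (by fun_prop) (by fun_prop)).inter
      (measurableSet_lt (by fun_prop) (by fun_prop))) (hg.comp (by fun_prop)) measurable_const
  rw [X.integral_transition p hm.stronglyMeasurable.integral_prod_right.measurable
    (C := C * (expWeight lam).real univ) (fun q => abs_integral_le_of_abs_le fun t => hb _ _)]
  -- Time is counted from the last jump, which brings out the discount accumulated up to it.
  have h1 : ∀ u : ℝ≥0, ∫ t, (if p.2 ≤ t ∧ t < p.2 + u then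
      extend f (X.position p.1 (t - p.2)) else 0) ∂expWeight lam =
      Real.exp (-lam * p.2) *
        ∫ s, (if s < u then extend f (X.position p.1 s) else 0) ∂expWeight lam := by
    intro u
    rw [← integral_expWeight_shift lam p.2 (Measurable.ite measurableSet_Iio hg measurable_const)]
    refine integral_congr_ae (Eventually.of_forall fun t => ?_)
    by_cases h : p.2 ≤ t
    · simp [h, tsub_lt_iff_left h]
    · simp [h]
  -- The new direction does not enter the interval that the jump ends, so its probability law
  -- integrates to one.
  simp only [h1, integral_const_mul, integral_const, probReal_univ, one_smul]
  congr 1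
  have hm' : Measurable fun q : ℝ≥0 × ℝ≥0 =>
      if q.2 < q.1 then extend f (X.position p.1 q.2) else 0 :=
    Measurable.ite (measurableSet_lt (by fun_prop) (by fun_prop)) (hg.comp (by fun_prop))
      measurable_const
  -- After the swap, the inner integral over the waiting time `u` is the value at `s` times the
  -- probability of `s < u`.
  rw [integral_integral_swap (.of_bound hm'.aestronglyMeasurable C
    (Eventually.of_forall fun _ => hb _ _)), pathResolvent, ← integral_exp_mul_expWeight lam 1 hg]
  refine integral_congr_ae (Eventually.of_forall fun s => ?_)
  have h2 : (fun u => if s < u then extend f (X.position p.1 s) else 0) =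
      (Ioi s).indicator fun _ => extend f (X.position p.1 s) := by
    ext u; simp [indicator_apply]
  simp only [h2]
  rw [integral_indicator_const _ measurableSet_Ioi, waitingTime_eq_expWeight,
    expWeight_one_real_Ioi]
  simp

/-! ### The law of the chain -/

lemma law_map_zero (x : K.Space) :
    (X.law x).map (fun ω => ω 0) = (K.linkKernel x).prod (Measure.dirac 0) := by
  have he : Measurable fun h : (i : Finset.Iic 0) → OnePoint K.Sphere × ℝ≥0 =>
    h ⟨0, Finset.mem_Iic.2 le_rfl⟩ := measurable_pi_apply _
  have hr : Measurable (Preorder.frestrictLe (π := fun _ => OnePoint K.Sphere × ℝ≥0) 0) :=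
    Preorder.measurable_frestrictLe 0
  change (X.law x).map ((fun h => h ⟨0, Finset.mem_Iic.2 le_rfl⟩) ∘
    Preorder.frestrictLe (π := fun _ => OnePoint K.Sphere × ℝ≥0) 0) = _
  rw [← Measure.map_map he hr, law,
    Kernel.trajMeasure, Measure.map_comp _ _ hr,
    Kernel.traj_map_frestrictLe, Kernel.partialTraj_self, Measure.id_comp,
    Measure.map_map he (by fun_prop)]
  exact Measure.map_id

/-- The Markov property. The trajectory measure satisfies it with the whole history up to `k` as
first component; as the kernel reads only the last coordinate, the history can be projected to it.
-/
lemma law_map_pair (x : K.Space) (k : ℕ) :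
    (X.law x).map (fun ω => (ω k, ω (k + 1))) =
      (X.law x).map (fun ω => ω k) ⊗ₘ X.transition := by
  have h := Kernel.map_frestrictLe_trajMeasure_compProd_eq_map_trajMeasure
    (X := fun _ => OnePoint K.Sphere × ℝ≥0)
    (κ := fun k => X.transition.comap (fun h => h ⟨k, Finset.mem_Iic.2 le_rfl⟩)
      (measurable_pi_apply _)) (μ₀ := (K.linkKernel x).prod (Measure.dirac 0)) (a := k)
  change (X.law x).map _ ⊗ₘ _ = (X.law x).map _ at h
  have he : Measurable fun h : (i : Finset.Iic k) → OnePoint K.Sphere × ℝ≥0 =>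
    h ⟨k, Finset.mem_Iic.2 le_rfl⟩ := measurable_pi_apply _
  have h' := congrArg (Measure.map (Prod.map (fun h => h ⟨k, Finset.mem_Iic.2 le_rfl⟩) id)) h
  rw [Measure.map_map (he.prodMap measurable_id) (by fun_prop)] at h'
  refine Eq.trans h'.symm ?_
  ext A hA
  have hc : (X.law x).map (fun ω => ω k) = ((X.law x).map (Preorder.frestrictLe
      (π := fun _ => OnePoint K.Sphere × ℝ≥0) k)).map
        fun h => h ⟨k, Finset.mem_Iic.2 le_rfl⟩ := by
    rw [Measure.map_map he (Preorder.measurable_frestrictLe k)]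
    rfl
  rw [Measure.map_apply (he.prodMap measurable_id) hA,
    Measure.compProd_apply (he.prodMap measurable_id hA), Measure.compProd_apply hA, hc,
    lintegral_map (Kernel.measurable_kernel_prodMk_left hA) he]
  rfl

lemma integral_law_pair (x : K.Space) (k : ℕ)
    {h : (OnePoint K.Sphere × ℝ≥0) × (OnePoint K.Sphere × ℝ≥0) → ℝ} (hh : Measurable h) {C : ℝ}
    (hC : ∀ q, |h q| ≤ C) :
    ∫ ω, h (ω k, ω (k + 1)) ∂X.law x = ∫ ω, ∫ q, h (ω k, q) ∂X.transition (ω k) ∂X.law x := by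
  have hk : Measurable fun ω : ℕ → OnePoint K.Sphere × ℝ≥0 => ω k := measurable_pi_apply k
  have hk' : Measurable fun ω : ℕ → OnePoint K.Sphere × ℝ≥0 => (ω k, ω (k + 1)) :=
    hk.prodMk (measurable_pi_apply _)
  have := Measure.isProbabilityMeasure_map (μ := X.law x) hk.aemeasurable
  rw [← integral_map hk'.aemeasurable (f := h) hh.aestronglyMeasurable, law_map_pair,
    Measure.integral_compProd (.of_bound hh.aestronglyMeasurable C (Eventually.of_forall hC)),
    integral_map hk.aemeasurable (hh.stronglyMeasurable.integral_kernel_prod_right'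
      (κ := X.transition)).aestronglyMeasurable]

/-- The sample space consists of all sequences, so the order of the jump times holds only almost
surely. -/
lemma ae_monotone_jumpTime (x : K.Space) : ∀ᵐ ω ∂X.law x, Monotone fun k => (ω k).2 := by
  have h : ∀ k, ∀ᵐ ω ∂X.law x, (ω k).2 ≤ (ω (k + 1)).2 := by
    intro k
    have hk : Measurable fun ω : ℕ → OnePoint K.Sphere × ℝ≥0 => ω k := measurable_pi_apply k
    have hk' : Measurable fun ω : ℕ → OnePoint K.Sphere × ℝ≥0 => (ω k, ω (k + 1)) :=
      hk.prodMk (measurable_pi_apply _)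
    have := Measure.isProbabilityMeasure_map (μ := X.law x) hk.aemeasurable
    have hm : MeasurableSet {q : (OnePoint K.Sphere × ℝ≥0) × (OnePoint K.Sphere × ℝ≥0) |
        q.1.2 ≤ q.2.2} := measurableSet_le (by fun_prop) (by fun_prop)
    have h1 : ∀ᵐ q ∂(X.law x).map (fun ω => ω k) ⊗ₘ X.transition, q.1.2 ≤ q.2.2 :=
      (Measure.ae_compProd_iff hm).2 (Eventually.of_forall X.ae_transition_le)
    rw [← law_map_pair, ae_map_iff hk'.aemeasurable hm] at h1
    exact h1
  filter_upwards [ae_all_iff.2 h] with ω hω using monotone_nat_of_le_succ hω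

/-- The recursion goes backwards along the chain: a step from `k + 1` to `k` replaces `f` by its
averaged resolvent. The induction therefore has to generalize over `f` and its bound. -/
lemma integral_law_exp_mul_pathResolvent {lam : ℝ} (hlam : 0 < lam) (k : ℕ) (x : K.Space)
    {f : K.Space → ℝ} (hf : Measurable f) {C : ℝ} (hC : ∀ x, |f x| ≤ C) :
    ∫ ω, Real.exp (-lam * (ω k).2) * X.pathResolvent (lam + 1) f (ω k).1 ∂X.law x =
      (X.averagedResolvent (lam + 1))^[k + 1] f x := by
  have ha : 0 < lam + 1 := by linarith
  induction k generalizing f C with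
  | zero =>
    have hG := X.measurable_pathResolvent ha hf
    have hm : Measurable fun p : OnePoint K.Sphere × ℝ≥0 =>
      Real.exp (-lam * p.2) * X.pathResolvent (lam + 1) f p.1 := by fun_prop
    have h0 : Measurable fun ω : ℕ → OnePoint K.Sphere × ℝ≥0 => ω 0 := measurable_pi_apply 0
    rw [← integral_map h0.aemeasurable (f := fun p : OnePoint K.Sphere × ℝ≥0 =>
      Real.exp (-lam * p.2) * X.pathResolvent (lam + 1) f p.1) hm.aestronglyMeasurable,
      law_map_zero, Measure.prod_dirac, integral_map (by fun_prop) hm.aestronglyMeasurable]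
    -- The chain starts at `τ_0 = 0`, so the exponential factor is one and only the link average
    -- remains.
    simp [X.averagedResolvent_eq ha hf hC]
  | succ k ih =>
    have hG := X.measurable_pathResolvent ha hf
    rw [Function.iterate_succ_apply, ← ih (X.measurable_averagedResolvent ha hf hC)
      (X.abs_averagedResolvent_le ha hf hC), X.integral_law_pair x k
      (h := fun q => Real.exp (-lam * q.2.2) * X.pathResolvent (lam + 1) f q.2.1) (by fun_prop)
      (fun q => abs_exp_neg_mul_le hlam.le _ (X.abs_pathResolvent_le ha hC _))]
    simp only [X.integral_exp_mul_pathResolvent_transition hlam hf hC]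

/-! ### Decomposition of the process over its jump intervals -/

/-- The value of `f` at the time `t` on the trajectory followed between the jumps `k` and `k + 1`,
and zero if `t` is not between these jumps. -/
def jumpTerm (f : K.Space → ℝ) (k : ℕ) (p : (ℕ → OnePoint K.Sphere × ℝ≥0) × ℝ≥0) : ℝ :=
  if (p.1 k).2 ≤ p.2 ∧ p.2 < (p.1 (k + 1)).2 then
    extend f (X.position (p.1 k).1 (p.2 - (p.1 k).2)) else 0

/-- For monotone jump times the half-open jump intervals are disjoint, so the first index found by
`Nat.find` is the only one. -/
lemma process_eq_position {ω : ℕ → OnePoint K.Sphere × ℝ≥0} (hω : Monotone fun k => (ω k).2)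
    {t : ℝ≥0} {k : ℕ} (hk : (ω k).2 ≤ t) (hk' : t < (ω (k + 1)).2) :
    X.process t ω = X.position (ω k).1 (t - (ω k).2) := by
  classical
  have h : ∃ i, (ω i).2 ≤ t ∧ t < (ω (i + 1)).2 := ⟨k, hk, hk'⟩
  have e : Nat.find h = k := by
    obtain ⟨h1, h2⟩ := Nat.find_spec h
    refine le_antisymm (Nat.find_min' h ⟨hk, hk'⟩) (not_lt.1 fun hlt => ?_)
    exact absurd (h2.trans_le ((hω hlt).trans hk)) (lt_irrefl _)
  rw [process, dif_pos h]
  convert rfl using 3 <;> simp [← e]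

/-- At most one term is nonzero. If `t` lies in no jump interval, all terms vanish, in agreement
with the value at the cemetery. -/
lemma hasSum_jumpTerm {ω : ℕ → OnePoint K.Sphere × ℝ≥0} (hω : Monotone fun k => (ω k).2)
    (f : K.Space → ℝ) (t : ℝ≥0) :
    HasSum (fun k => X.jumpTerm f k (ω, t)) (extend f (X.process t ω)) := by
  by_cases h : ∃ i, (ω i).2 ≤ t ∧ t < (ω (i + 1)).2
  · obtain ⟨k, hk, hk'⟩ := h
    rw [X.process_eq_position hω hk hk']
    have e : X.jumpTerm f k (ω, t) = extend f (X.position (ω k).1 (t - (ω k).2)) :=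
      if_pos ⟨hk, hk'⟩
    rw [← e]
    refine hasSum_single k fun j hj => if_neg fun ⟨h1, h2⟩ => ?_
    rcases lt_or_gt_of_ne hj with hlt | hlt
    · exact absurd (h2.trans_le ((hω hlt).trans hk)) (lt_irrefl _)
    · exact absurd (hk'.trans_le ((hω hlt).trans h1)) (lt_irrefl _)
  · have e : X.process t ω = OnePoint.infty := by rw [process, dif_neg h]
    rw [e, extend_infty]
    convert hasSum_zero with k
    exact if_neg fun hk => h ⟨k, hk⟩

lemma measurableSet_jumpInterval (k : ℕ) :
    MeasurableSet {p : (ℕ → OnePoint K.Sphere × ℝ≥0) × ℝ≥0 |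
      (p.1 k).2 ≤ p.2 ∧ p.2 < (p.1 (k + 1)).2} :=
  (measurableSet_le (by fun_prop) (by fun_prop)).inter
    (measurableSet_lt (by fun_prop) (by fun_prop))

lemma measurable_position_sub (k : ℕ) :
    Measurable fun p : (ℕ → OnePoint K.Sphere × ℝ≥0) × ℝ≥0 =>
      X.position (p.1 k).1 (p.2 - (p.1 k).2) :=
  X.measurable_position.comp (f := fun p : (ℕ → OnePoint K.Sphere × ℝ≥0) × ℝ≥0 =>
    ((p.1 k).1, p.2 - (p.1 k).2)) (by fun_prop)

lemma measurable_jumpTerm {f : K.Space → ℝ} (hf : Measurable f) (k : ℕ) :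
    Measurable (X.jumpTerm f k) :=
  Measurable.ite (measurableSet_jumpInterval k)
    ((measurable_extend hf).comp (X.measurable_position_sub k)) measurable_const

lemma abs_jumpTerm_le {f : K.Space → ℝ} {C : ℝ} (hC : ∀ x, |f x| ≤ C) (k : ℕ)
    (p : (ℕ → OnePoint K.Sphere × ℝ≥0) × ℝ≥0) : |X.jumpTerm f k p| ≤ C := by
  unfold jumpTerm
  split_ifs
  · exact abs_extend_le hC _
  · simpa using nonneg_of_abs_le hC

/-- Lets the exact formula for the integrals, applied to `|f|`, provide the absolute convergence. -/
lemma abs_jumpTerm (f : K.Space → ℝ) (k : ℕ) (p : (ℕ → OnePoint K.Sphere × ℝ≥0) × ℝ≥0) :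
    |X.jumpTerm f k p| = X.jumpTerm (fun x => |f x|) k p := by
  unfold jumpTerm
  split_ifs
  · exact abs_extend f _
  · exact abs_zero

lemma measurable_process :
    Measurable fun p : (ℕ → OnePoint K.Sphere × ℝ≥0) × ℝ≥0 => X.process p.2 p.1 := by
  classical
  let P : ℕ → Set ((ℕ → OnePoint K.Sphere × ℝ≥0) × ℝ≥0) := fun k =>
    {p | (p.1 k).2 ≤ p.2 ∧ p.2 < (p.1 (k + 1)).2}
  have hP : ∀ k, MeasurableSet (P k) := measurableSet_jumpInterval
  intro A hA
  -- Jump times need not be ordered here, so the sets `P k` may overlap. Removing the earlier ones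
  -- leaves the set on which `Nat.find` takes the value `k`.
  have e : (fun p : (ℕ → OnePoint K.Sphere × ℝ≥0) × ℝ≥0 => X.process p.2 p.1) ⁻¹' A =
      (⋃ k, (P k \ ⋃ j < k, P j) ∩
        (fun p => X.position (p.1 k).1 (p.2 - (p.1 k).2)) ⁻¹' A) ∪
      ((⋃ k, P k)ᶜ ∩ {_p | OnePoint.infty ∈ A}) := by
    ext p
    by_cases h : ∃ i, (p.1 i).2 ≤ p.2 ∧ p.2 < (p.1 (i + 1)).2
    · have hp : p ∈ ⋃ k, P k := mem_iUnion.2 h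
      have hf : ∀ k, p ∈ P k \ ⋃ j < k, P j ↔ Nat.find h = k := by
        intro k
        rw [Nat.find_eq_iff]
        simp only [P, Set.mem_sdiff, mem_iUnion, mem_ofPred_eq, exists_prop, not_exists, not_and]
      have e1 : X.process p.2 p.1 =
          X.position (p.1 (Nat.find h)).1 (p.2 - (p.1 (Nat.find h)).2) := by
        rw [process, dif_pos h]
      simp only [mem_preimage, e1, mem_union, mem_iUnion (s := fun k => (P k \ ⋃ j < k, P j) ∩ _),
        mem_inter_iff, hf, mem_compl_iff, hp]
      simp
    · have hp : p ∉ ⋃ k, P k := fun hp => h (mem_iUnion.1 hp)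
      have hp' : ∀ k, p ∉ P k := fun k hk => hp (mem_iUnion.2 ⟨k, hk⟩)
      have e1 : X.process p.2 p.1 = OnePoint.infty := by rw [process, dif_neg h]
      simp [e1, hp']
  rw [e]
  refine (MeasurableSet.iUnion fun k => ((hP k).diff (.biUnion (to_countable _) fun j _ => hP j)).inter
    (X.measurable_position_sub k hA)).union ((MeasurableSet.iUnion hP).compl.inter (.const _))

/-! ### The resolvent series -/

/-- After integration over time, the `k`-th term depends only on the states `k` and `k + 1`.
Conditioning on the state `k` yields the discounted trajectory resolvent, whose expectation is
known. -/
lemma integral_jumpTerm {lam : ℝ} (hlam : 0 < lam) (k : ℕ) (x : K.Space) {f : K.Space → ℝ}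
    (hf : Measurable f) {C : ℝ} (hC : ∀ x, |f x| ≤ C) :
    ∫ p, X.jumpTerm f k p ∂(X.law x).prod (expWeight lam) =
      (X.averagedResolvent (lam + 1))^[k + 1] f x := by
  have := isFiniteMeasure_expWeight hlam
  rw [integral_prod _ (.of_bound (X.measurable_jumpTerm hf k).aestronglyMeasurable C
    (Eventually.of_forall (X.abs_jumpTerm_le hC k))),
    ← X.integral_law_exp_mul_pathResolvent hlam k x hf hC]
  have hC0 := nonneg_of_abs_le hC
  have hm : Measurable fun q : ((OnePoint K.Sphere × ℝ≥0) × (OnePoint K.Sphere × ℝ≥0)) × ℝ≥0 =>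
      if q.1.1.2 ≤ q.2 ∧ q.2 < q.1.2.2 then
        extend f (X.position q.1.1.1 (q.2 - q.1.1.2)) else 0 :=
    Measurable.ite ((measurableSet_le (by fun_prop) (by fun_prop)).inter
      (measurableSet_lt (by fun_prop) (by fun_prop)))
      ((X.measurable_extend_position hf).comp (f := fun
        q : ((OnePoint K.Sphere × ℝ≥0) × (OnePoint K.Sphere × ℝ≥0)) × ℝ≥0 =>
          (q.1.1.1, q.2 - q.1.1.2)) (by fun_prop)) measurable_const
  have h := X.integral_law_pair x k (h := fun q =>
    ∫ t, (if q.1.2 ≤ t ∧ t < q.2.2 then extend f (X.position q.1.1 (t - q.1.2)) else 0)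
      ∂expWeight lam) hm.stronglyMeasurable.integral_prod_right.measurable
    (C := C * (expWeight lam).real univ) (fun q => abs_integral_le_of_abs_le fun t => by
      split_ifs
      · exact abs_extend_le hC _
      · simpa using hC0)
  simp only [X.integral_transition_integral_expWeight hlam hf hC] at h
  exact h

lemma measurable_expectation {f : K.Space → ℝ} (hf : Measurable f) (x : K.Space) :
    Measurable fun t => X.expectation t f x :=
  StronglyMeasurable.measurable <| StronglyMeasurable.integral_prod_left
    (f := fun ω t => extend f (X.process t ω))
    ((measurable_extend hf).comp X.measurable_process).stronglyMeasurable

lemma abs_expectation_le {f : K.Space → ℝ} {C : ℝ} (hC : ∀ x, |f x| ≤ C) (t : ℝ≥0) (x : K.Space) :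
    |X.expectation t f x| ≤ C := by
  have h := abs_integral_le_of_abs_le (μ := X.law x) fun ω => abs_extend_le hC (X.process t ω)
  rwa [probReal_univ, mul_one] at h

lemma resolvent_eq {lam : ℝ} (hlam : 0 < lam) {f : K.Space → ℝ} (hf : Measurable f) {C : ℝ}
    (hC : ∀ x, |f x| ≤ C) (x : K.Space) :
    X.resolvent lam f x =
      ∫ p, extend f (X.process p.2 p.1) ∂(X.law x).prod (expWeight lam) := by
  have := isFiniteMeasure_expWeight hlam
  rw [resolvent, ← integral_expWeight lam (X.measurable_expectation hf x),
    integral_prod_symm _ (integrable_extend_comp hf hC X.measurable_process)]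
  rfl

lemma summable_resolventBound {lam : ℝ} (hlam : 0 < lam) (C : ℝ) :
    Summable fun k : ℕ => (1 / (lam + 1)) ^ (k + 1) * C := by
  refine Summable.mul_right C ((summable_nat_add_iff 1).2 (summable_geometric_of_lt_one
    (by positivity) ?_))
  rw [div_lt_one (by linarith)]
  linarith

/-- Sum and integral are exchanged because the `L¹` norms of the terms are the iterates applied to
`|f|`, which a geometric series dominates. -/
lemma hasSum_resolvent {lam : ℝ} (hlam : 0 < lam) {f : K.Space → ℝ} (hf : Measurable f) {C : ℝ}
    (hC : ∀ x, |f x| ≤ C) (x : K.Space) :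
    HasSum (fun k => (X.averagedResolvent (lam + 1))^[k + 1] f x) (X.resolvent lam f x) := by
  have := isFiniteMeasure_expWeight hlam
  have ha : 0 < lam + 1 := by linarith
  have hf' : Measurable fun x => |f x| := hf.abs
  have hC' : ∀ x, |(|f x|)| ≤ C := by simpa using hC
  have h := hasSum_integral_of_summable_integral_norm (μ := (X.law x).prod (expWeight lam))
    (F := X.jumpTerm f) (fun k => .of_bound (X.measurable_jumpTerm hf k).aestronglyMeasurable C
      (Eventually.of_forall (X.abs_jumpTerm_le hC k))) (by
    simp only [Real.norm_eq_abs, abs_jumpTerm, X.integral_jumpTerm hlam _ x hf' hC']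
    exact .of_norm_bounded (summable_resolventBound hlam C) fun k =>
      (X.iterate_averagedResolvent ha hf' hC' (k + 1)).2 x)
  simp only [X.integral_jumpTerm hlam _ x hf hC] at h
  rw [X.resolvent_eq hlam hf hC]
  have hae : ∀ᵐ p : (ℕ → OnePoint K.Sphere × ℝ≥0) × ℝ≥0 ∂(X.law x).prod (expWeight lam),
      Monotone fun k => (p.1 k).2 :=
    Measure.quasiMeasurePreserving_fst.ae (X.ae_monotone_jumpTime x)
  rwa [integral_congr_ae (hae.mono fun p hp => (X.hasSum_jumpTerm hp f p.2).tsum_eq)] at h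

end GeodesicFlow

end RiemannianComplex

end TransportProcess

end

/-! ### The resolvent series -/

theorem proposition2p4 {V : Type*} {n : ℕ}
    (K : TransportProcess.RiemannianComplex V n) (X : K.GeodesicFlow)
    (f : K.Space → ℝ) (hf : Measurable f) (C : ℝ) (hC : ∀ x, |f x| ≤ C)
    (lam : ℝ) (hlam : 0 < lam) :
    -- all the integrals that define the operators converge
    (∀ t x, Integrable (fun z => TransportProcess.RiemannianComplex.GeodesicFlow.extend f
        (X.toFun z t)) (K.uniformMeasure x)) ∧
    (∀ x, IntegrableOn (fun t : ℝ => Real.exp (-(lam + 1) * t) * X.averaged t.toNNReal f x)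
        (Ioi 0)) ∧
    (∀ t x, Integrable (fun ω => TransportProcess.RiemannianComplex.GeodesicFlow.extend f
        (X.process t ω)) (X.law x)) ∧
    (∀ x, IntegrableOn (fun t : ℝ => Real.exp (-lam * t) * X.expectation t.toNNReal f x)
        (Ioi 0)) ∧
    -- the operator `R⁰_{lam + 1}` acts on the bounded Borel functions, with norm `≤ 1 / (lam + 1)`
    Measurable (X.averagedResolvent (lam + 1) f) ∧
    (∀ x, |X.averagedResolvent (lam + 1) f x| ≤ 1 / (lam + 1) * C) ∧
    -- the series of the iterates of `R⁰_{lam + 1}` converges uniformly to `R_lam f`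
    TendstoUniformly
      (fun N x => ∑ k ∈ Finset.range N, ((X.averagedResolvent (lam + 1))^[k + 1] f) x)
      (X.resolvent lam f) atTop := by
  have ha : 0 < lam + 1 := by linarith
  have h1 := TransportProcess.isFiniteMeasure_expWeight ha
  have h2 := TransportProcess.isFiniteMeasure_expWeight hlam
  refine ⟨fun t x => TransportProcess.RiemannianComplex.GeodesicFlow.integrable_extend_comp hf hC
      (X.measurable_toFun.comp measurable_prodMk_right),
    fun x => ?_,
    fun t x => TransportProcess.RiemannianComplex.GeodesicFlow.integrable_extend_comp hf hC
      (X.measurable_process.comp measurable_prodMk_right),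
    fun x => ?_, X.measurable_averagedResolvent ha hf hC,
    X.abs_averagedResolvent_le ha hf hC, ?_⟩
  · exact (TransportProcess.integrableOn_exp_mul_iff _ (X.measurable_averaged hf x)).2
      (.of_bound (X.measurable_averaged hf x).aestronglyMeasurable C
        (Eventually.of_forall fun t => X.abs_averaged_le hC t x))
  · exact (TransportProcess.integrableOn_exp_mul_iff _ (X.measurable_expectation hf x)).2
      (.of_bound (X.measurable_expectation hf x).aestronglyMeasurable C
        (Eventually.of_forall fun t => X.abs_expectation_le hC t x))
  -- The Weierstrass test, with majorants independent of `x`; the pointwise sum is already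
  -- identified.
  · have h := tendstoUniformly_tsum_nat
      (TransportProcess.RiemannianComplex.GeodesicFlow.summable_resolventBound hlam C)
      (f := fun k => (X.averagedResolvent (lam + 1))^[k + 1] f)
      fun k x => (X.iterate_averagedResolvent ha hf hC (k + 1)).2 x
    rwa [funext fun x => (X.hasSum_resolvent hlam hf hC x).tsum_eq] at h
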